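/- **Setting.** All Hilbert spaces are complex; $T>0$. Let $S=\begin{bmatrix}A\&B\\ C\&D\end{bmatrix}$ be a system node on $(X,U,Y)$: $A\&B:\operatorname{dom}(A\&B)\subset X\times U\to X$ is closed, $C\&D:\operatorname{dom}(A\&B)\to Y$ is bounded for the graph norm of $A\&B$, for each $u\in U$ there is $x\in X$ with $(x,u)\in\operatorname{dom}(A\&B)$, and the main operator $Ax=A\&B(x,0)$, $\operatorname{dom}A=\{x:(x,0)\in\operatorname{dom}(A\&B)\}$, generates a strongly continuous semigroup $\mathfrak A$ on $X$. Fix $\alpha\in\mathbb R$ with $\alpha I-A$ bijective, let $X_{-1}$ be the completion of $X$ for $\|x\|_{-1}=\|(\alpha I-A)^{-1}x\|$, let $A_{-1}$ and $\mathfrak A_{-1}$ be the extensions of $A$ and $\mathfrak A$ to $X$ and $X_{-1}$ with values in $X_{-1}$, and let $B\in L(U,X_{-1})$ be the operator with $A\&B(x,u)=A_{-1}x+Bu$ on $\operatorname{dom}(A\&B)$. Let $H^{-2}_{0l}([0,T];Y)$ be the antidual of $H^2_{0r}([0,T];Y)=\{w\in H^2:w(T)=w'(T)=0\}$ with pivot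 space $L^2$, and define $(\tfrac{d^2}{dt^2})_l:L^2\to H^{-2}_{0l}$ by $\langle(\tfrac{d^2}{dt^2})_lv,w\rangle=\langle v,w''\rangle_{L^2}$. For $u\in L^2([0,T];U)$ and $x_0\in X_{-1}$ put $$\mathfrak B_tu=\int_0^t\mathfrak A_{-1}(t-s)Bu(s)\,ds\in X_{-1},\qquad \mathfrak C_Tx_0=\big(\tfrac{d^2}{dt^2}\big)_l\,C\&D\int_0^\cdot(\cdot-\tau)\begin{pmatrix}\mathfrak A_{-1}(\tau)x_0\\0\end{pmatrix}d\tau,$$ $$\mathfrak D_Tu=\big(\tfrac{d^2}{dt^2}\big)_l\,C\&D\int_0^\cdot(\cdot-\tau)\begin{pmatrix}\mathfrak B_\tau u\\u(\tau)\end{pmatrix}d\tau .$$ For a Hilbert space $Z$ and $F\in L(X,Z)$, let $\mathfrak T_{F,T}$ be the closure with respect to $u$ of $(x_0,u)\mapsto F(\mathfrak A_{-1}(T)x_0+\mathfrak B_Tu)$, defined where $\mathfrak A_{-1}(T)x_0+\mathfrak B_Tu\in X$; that is, $(x_0,u)\in\operatorname{dom}\mathfrak T_{F,T}$ and $\mathfrak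 T_{F,T}(x_0,u)=z$ if and only if there are $u_n\to u$ in $L^2([0,T];U)$ with $\mathfrak A_{-1}(T)x_0+\mathfrak B_Tu_n\in X$ and $F(\mathfrak A_{-1}(T)x_0+\mathfrak B_Tu_n)\to z$ in $Z$. (The closure is understood as a linear relation; "$\mathfrak T_{F,T}(x_0,u)=z$" means that the pair lies in this relation.) Let $$\mathcal B_F=\Big\{w\in Z: B^*\int_0^\cdot(\cdot-\tau)\mathfrak A(\tau)^*F^*w\,d\tau\in H^2([0,T];U)\text{ and vanishes at }0\text{ together with its derivative}\Big\}.$$ A classical trajectory is $(x,u,y)\in C^1([0,T];X)\times C([0,T];U)\times C([0,T];Y)$ with $\dot x=A\&B(x,u)$, $y=C\&D(x,u)$ on $[0,T]$; a generalized trajectory is a limit of such in $C([0,T];X)\times L^2\times L^2$. **Assumptions.** $Z,Z_c$ are Hilbert spaces, $F\in L(X,Z)$, $F_c\in L(X,Z_c)$, $\mathcal B_F$ is dense in $Z$ and $\mathcal B_{F_c}$ is dense in $Z_c$; $x_0\in X_{-1}$, $z_f\in Z$, $z_c\in Z_c$, $y_{\rm ref}\in L^2([0,T];Y)$; $\mathcal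 U_{\rm ad}\subset L^2([0,T];U)$ is closed and convex. At least one of the following holds: (i) $\mathcal U_{\rm ad}$ is bounded; (ii) there is $c>0$ with $\|y\|_{L^2}^2+\|Fx(T)\|_Z\ge c\|u\|_{L^2}^2$ for all generalized trajectories $(x,u,y)$ with $x(0)=0$; (iii) there is $c>0$ with $\|\mathfrak D_Tu\|_{L^2}^2+\|z\|_Z^2\ge c\|u\|_{L^2}^2$ for all $u,z$ with $\mathfrak T_{F,T}(0,u)=z$ and $\mathfrak D_Tu\in L^2([0,T];Y)$. The set $\mathcal R_{F_c}=\{\mathfrak T_{F_c,T}(0,u):(0,u)\in\operatorname{dom}\mathfrak T_{F_c,T}\}$ is closed in $Z_c$. With $$\widetilde{\mathcal U}_{\rm ad}=\{u\in\mathcal U_{\rm ad}:(x_0,u)\in\operatorname{dom}\mathfrak T_{F,T},\ \mathfrak T_{F_c,T}(x_0,u)=z_c\}$$ there is $\hat u\in\widetilde{\mathcal U}_{\rm ad}$ with $\mathfrak C_Tx_0+\mathfrak D_T\hat u\in L^2([0,T];Y)$. **Conclusion.** Let $\mathcal J(u)=\tfrac12\|\mathfrak T_{F,T}(x_0,u)-z_f\|_Z^2+\tfrac12\|\mathfrak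 C_Tx_0+\mathfrak D_Tu-y_{\rm ref}\|_{L^2}^2$ if $(x_0,u)\in\operatorname{dom}\mathfrak T_{F,T}$ and $\mathfrak C_Tx_0+\mathfrak D_Tu\in L^2([0,T];Y)$ (the infimum over the values of $\mathfrak T_{F,T}(x_0,u)$, should there be more than one), and $\mathcal J(u)=\infty$ otherwise. Then there is $u_{\rm opt}\in\widetilde{\mathcal U}_{\rm ad}$ with $\mathcal J(u_{\rm opt})=\inf_{u\in\widetilde{\mathcal U}_{\rm ad}}\mathcal J(u)$. -/

import Mathlib

open MeasureTheory Filter Topology Set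
open scoped NNReal ENNReal

noncomputable section

namespace SysNode

/-! ### Strongly continuous semigroups -/

/-- Strongly continuous semigroup of bounded operators. Only the values `𝔄 t` with `t ≥ 0` matter. -/
structure IsC0Semigroup {X : Type*} [NormedAddCommGroup X] [NormedSpace ℂ X]
    (𝔄 : ℝ → X →L[ℂ] X) : Prop where
  zero : 𝔄 0 = ContinuousLinearMap.id ℂ X
  add : ∀ s t : ℝ, 0 ≤ s → 0 ≤ t → 𝔄 (s + t) = (𝔄 s).comp (𝔄 t)
  cont : ∀ x : X, ContinuousOn (fun t => 𝔄 t x) (Ici 0)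

/-- `A` is the (infinitesimal) generator of the semigroup `𝔄`: the domain of `A` is exactly the set
of `x` for which the limit `lim_{h ↓ 0} h⁻¹ (𝔄 h x - x)` exists, and `A x` is this limit. -/
def IsGenerator {X : Type*} [NormedAddCommGroup X] [NormedSpace ℂ X]
    (𝔄 : ℝ → X →L[ℂ] X) (A : X →ₗ.[ℂ] X) : Prop :=
  ∀ x y : X, (x, y) ∈ A.graph ↔
    Tendsto (fun h : ℝ => h⁻¹ • (𝔄 h x - x)) (𝓝[>] 0) (𝓝 y)

section semigroupFacts

variable {X : Type*} [NormedAddCommGroup X] [NormedSpace ℂ X]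
  {𝔄 : ℝ → X →L[ℂ] X} {A : X →ₗ.[ℂ] X}

theorem IsC0Semigroup.add_apply (h : IsC0Semigroup 𝔄) {s t : ℝ} (hs : 0 ≤ s) (ht : 0 ≤ t) (x : X) :
    𝔄 (s + t) x = 𝔄 s (𝔄 t x) := by
  rw [h.add s t hs ht]; rfl

theorem IsGenerator.map_mem (hA : IsC0Semigroup 𝔄) (hG : IsGenerator 𝔄 A) {x y : X}
    (hxy : (x, y) ∈ A.graph) {t : ℝ} (ht : 0 ≤ t) : (𝔄 t x, 𝔄 t y) ∈ A.graph := by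
  rw [hG] at hxy ⊢
  have h1 := ((𝔄 t).continuous.tendsto y).comp hxy
  refine h1.congr' ?_
  filter_upwards [self_mem_nhdsWithin] with h hh
  have hh' : (0 : ℝ) ≤ h := le_of_lt hh
  have e : 𝔄 h (𝔄 t x) = 𝔄 t (𝔄 h x) := by
    rw [← hA.add_apply hh' ht, ← hA.add_apply ht hh', add_comm]
  simp only [Function.comp]
  rw [e, ← map_sub]
  exact ((𝔄 t).toLinearMap.restrictScalars ℝ).map_smul _ _

theorem IsC0Semigroup.continuous_max (hA : IsC0Semigroup 𝔄) (x : X) :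
    Continuous fun s : ℝ => 𝔄 (max s 0) x := by
  have := (hA.cont x).comp_continuous (f := fun s : ℝ => max s 0) (by fun_prop)
    (fun s => le_max_right s 0)
  exact this

/-- The basic identity `(α - A) ∫₀ᵗ e^{-αs} 𝔄(s) x ds = x - e^{-αt} 𝔄(t) x`. -/
theorem IsGenerator.integral_mem [CompleteSpace X] (hA : IsC0Semigroup 𝔄) (hG : IsGenerator 𝔄 A)
    (α : ℝ) {t : ℝ} (ht : 0 ≤ t) (x : X) :
    (∫ s in (0 : ℝ)..t, Real.exp (-(α * s)) • 𝔄 (max s 0) x,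
      α • (∫ s in (0 : ℝ)..t, Real.exp (-(α * s)) • 𝔄 (max s 0) x)
        - (x - Real.exp (-(α * t)) • 𝔄 t x)) ∈ A.graph := by
  set φ : ℝ → X := fun s => Real.exp (-(α * s)) • 𝔄 (max s 0) x with hφ
  have hc : Continuous φ := by
    exact (by fun_prop : Continuous fun s : ℝ => Real.exp (-(α * s))).smul (hA.continuous_max x)
  set Φ : ℝ → X := fun r => ∫ s in (0 : ℝ)..r, φ s with hΦ
  have hd : ∀ r, HasDerivAt Φ (φ r) r := fun r => hc.integral_hasStrictDerivAt 0 r |>.hasDerivAt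
  have key : ∀ h : ℝ, 0 ≤ h → 𝔄 h (Φ t) = Real.exp (α * h) • (Φ (t + h) - Φ h) := by
    intro h hh
    have e1 : 𝔄 h (Φ t) = ∫ s in (0 : ℝ)..t, 𝔄 h (φ s) :=
      ((𝔄 h).intervalIntegral_comp_comm (hc.intervalIntegrable 0 t)).symm
    have e2 : Φ (t + h) - Φ h = ∫ s in (h : ℝ)..(t + h), φ s := by
      rw [hΦ, intervalIntegral.integral_interval_sub_left (hc.intervalIntegrable _ _)
        (hc.intervalIntegrable _ _)]
    have e3 : (∫ s in (h : ℝ)..(t + h), φ s) = ∫ s in (0 : ℝ)..t, φ (s + h) := by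
      rw [intervalIntegral.integral_comp_add_right, zero_add]
    rw [e1, e2, e3, ← intervalIntegral.integral_smul]
    refine intervalIntegral.integral_congr fun s hs => ?_
    rw [uIcc_of_le ht] at hs
    have hs0 := hs.1
    simp only [hφ]
    rw [max_eq_left hs0, max_eq_left (add_nonneg hs0 hh), add_comm s h, hA.add_apply hh hs0,
      smul_smul, ← Real.exp_add]
    have : α * h + -(α * (h + s)) = -(α * s) := by ring
    rw [this]
    exact ((𝔄 h).toLinearMap.restrictScalars ℝ).map_smul _ _
  rw [hG]
  have hΨ : HasDerivAt (fun h : ℝ => Real.exp (α * h) • (Φ (t + h) - Φ h))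
      (α • Φ t - (x - Real.exp (-(α * t)) • 𝔄 t x)) 0 := by
    have d1 : HasDerivAt (fun h : ℝ => Φ (t + h)) (φ t) 0 := by
      have := hd (t + 0)
      have := HasDerivAt.scomp (0 : ℝ) this ((hasDerivAt_id (0 : ℝ)).const_add t)
      simpa [Function.comp_def] using this
    have d2 := d1.sub (hd 0)
    have d3 : HasDerivAt (fun h : ℝ => Real.exp (α * h)) α 0 := by
      have := ((hasDerivAt_id (0 : ℝ)).const_mul α).exp
      simpa using this
    have d4 := d3.smul d2
    have e0 : φ 0 = x := by simp [hφ, hA.zero]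
    have e1 : φ t = Real.exp (-(α * t)) • 𝔄 t x := by simp only [hφ, max_eq_left ht]
    have e2 : Φ 0 = 0 := by simp [hΦ]
    have e3 : ((fun h => Φ (t + h)) - Φ) 0 = Φ t := by simp [e2]
    have e4 : x - Real.exp (-(α * t)) • 𝔄 t x = -(φ t - φ 0) := by rw [e0, e1, neg_sub]
    rw [e3, mul_zero, Real.exp_zero, one_smul, add_comm] at d4
    rw [e4, sub_neg_eq_add]
    exact d4
  refine hΨ.tendsto_slope_zero_right.congr' ?_
  filter_upwards [self_mem_nhdsWithin] with h hh
  have hh' : (0 : ℝ) ≤ h := le_of_lt hh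
  rw [key h hh']
  simp [hΦ]

theorem IsGenerator.dense_domain [CompleteSpace X] (hA : IsC0Semigroup 𝔄)
    (hG : IsGenerator 𝔄 A) : Dense (A.domain : Set X) := by
  intro x
  have hc := hA.continuous_max x
  have hd : HasDerivAt (fun r : ℝ => ∫ s in (0 : ℝ)..r, 𝔄 (max s 0) x) x 0 := by
    have := (hc.integral_hasStrictDerivAt 0 0).hasDerivAt
    simpa [hA.zero] using this
  have hl := hd.tendsto_slope_zero_right
  refine mem_closure_of_tendsto hl ?_
  filter_upwards [self_mem_nhdsWithin] with h hh
  have hm := LinearPMap.mem_domain_of_mem_graph (hG.integral_mem hA 0 (le_of_lt hh) x)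
  simp only [zero_mul, neg_zero, Real.exp_zero, one_smul] at hm
  have := (A.domain.restrictScalars ℝ).smul_mem (h⁻¹) hm
  simpa using this

theorem IsGenerator.eq_exp_smul (hA : IsC0Semigroup 𝔄) (hG : IsGenerator 𝔄 A)
    {α : ℝ} {x : X} (hx : (x, (α : ℂ) • x) ∈ A.graph) {t : ℝ} (ht : 0 ≤ t) :
    Real.exp (-(α * t)) • 𝔄 t x = x := by
  have hc : ContinuousOn (fun s : ℝ => Real.exp (-(α * s)) • 𝔄 s x) (Icc 0 t) := by
    exact (by fun_prop : ContinuousOn (fun s : ℝ => Real.exp (-(α * s))) (Icc 0 t)).smul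
      ((hA.cont x).mono fun s hs => hs.1)
  have hd : ∀ s ∈ Ico 0 t,
      HasDerivWithinAt (fun s : ℝ => Real.exp (-(α * s)) • 𝔄 s x) 0 (Ici s) s := by
    intro s hs
    have h1 : HasDerivWithinAt (fun s : ℝ => 𝔄 s x) (α • 𝔄 s x) (Ici s) s := by
      have := (hG _ _).1 (hG.map_mem hA hx hs.1)
      have g0 : HasDerivWithinAt (fun h : ℝ => 𝔄 h (𝔄 s x)) (𝔄 s ((α : ℂ) • x)) (Ici 0) 0 := by
        rw [← hasDerivWithinAt_Ioi_iff_Ici, hasDerivWithinAt_iff_tendsto_slope' (by simp)]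
        refine this.congr fun h => ?_
        simp [slope_def_module, hA.zero]
      have g1 : HasDerivWithinAt (fun r : ℝ => 𝔄 (r - s) (𝔄 s x)) (𝔄 s ((α : ℂ) • x))
          (Ici s) s := by
        have := HasDerivWithinAt.scomp (h := fun r : ℝ => r - s) (h' := 1) (s := Ici s)
          (t' := Ici 0) s (by simpa using g0)
          ((hasDerivWithinAt_id s _).sub_const s) (fun r hr => sub_nonneg.2 hr)
        simpa [Function.comp_def] using this
      have g2 : 𝔄 s ((α : ℂ) • x) = α • 𝔄 s x := by
        rw [map_smul]; exact Complex.coe_smul α _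
      rw [g2] at g1
      refine g1.congr (fun r hr => ?_) ?_
      · rw [← hA.add_apply (sub_nonneg.2 hr) hs.1, sub_add_cancel]
      · simp [hA.zero]
    have h2 : HasDerivAt (fun s : ℝ => Real.exp (-(α * s))) (-(α * Real.exp (-(α * s)))) s := by
      have h3 : HasDerivAt (fun s : ℝ => -(α * s)) (-α) s := by
        have h4 := (hasDerivAt_id s).const_mul (-α)
        simp only [mul_one, id_eq, neg_mul] at h4
        exact h4
      have := h3.exp
      convert this using 1
      ring
    have h4 := h2.hasDerivWithinAt.smul h1
    have h5 : Real.exp (-(α * s)) • α • 𝔄 s x + -(α * Real.exp (-(α * s))) • 𝔄 s x = 0 := by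
      rw [smul_smul, ← add_smul, mul_comm, add_neg_cancel, zero_smul]
    rw [h5] at h4
    exact h4
  have := constant_of_has_deriv_right_zero hc hd t ⟨ht, le_rfl⟩
  simpa [hA.zero] using this

/-- The generator of a strongly continuous semigroup has real resolvent points. -/
theorem IsGenerator.exists_resolvent [CompleteSpace X] (hA : IsC0Semigroup 𝔄)
    (hG : IsGenerator 𝔄 A) :
    ∃ α : ℝ, Function.Bijective fun x : A.domain => (α : ℂ) • (x : X) - A x := by
  obtain ⟨α, hα⟩ : ∃ α : ℝ, Real.exp (-α) * ‖𝔄 1‖ < 1 := by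
    have : Tendsto (fun α : ℝ => Real.exp (-α) * ‖𝔄 1‖) atTop (𝓝 (0 * ‖𝔄 1‖)) :=
      (Real.tendsto_exp_neg_atTop_nhds_zero).mul_const _
    rw [zero_mul] at this
    exact (this.eventually_lt_const one_pos).exists
  refine ⟨α, ?_, ?_⟩
  · intro a b hab
    have h0 : (α : ℂ) • ((a - b : A.domain) : X) - A (a - b) = 0 := by
      have hab' : (α : ℂ) • (a : X) - A a = (α : ℂ) • (b : X) - A b := hab
      rw [LinearPMap.map_sub, Submodule.coe_sub, smul_sub, sub_sub_sub_comm, hab', sub_self]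
    have hm : (((a - b : A.domain) : X), (α : ℂ) • ((a - b : A.domain) : X)) ∈ A.graph := by
      rw [sub_eq_zero.1 h0]; exact A.mem_graph _
    have he := hG.eq_exp_smul hA hm zero_le_one
    rw [mul_one] at he
    set x : X := ((a - b : A.domain) : X) with hx
    have hx0 : x = 0 := by
      by_contra hne
      have hpos : 0 < ‖x‖ := norm_pos_iff.2 hne
      have : ‖x‖ ≤ Real.exp (-α) * ‖𝔄 1‖ * ‖x‖ := by
        calc ‖x‖ = ‖Real.exp (-α) • 𝔄 1 x‖ := by rw [he]
          _ = Real.exp (-α) * ‖𝔄 1 x‖ := by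
            rw [norm_smul, Real.norm_eq_abs, abs_of_pos (Real.exp_pos _)]
          _ ≤ Real.exp (-α) * (‖𝔄 1‖ * ‖x‖) := by
            gcongr; exact (𝔄 1).le_opNorm x
          _ = _ := by ring
      nlinarith
    exact sub_eq_zero.1 (Subtype.ext hx0)
  · intro y
    have hn : ‖(Real.exp (-α) : ℂ) • 𝔄 1‖ < 1 := by
      rw [norm_smul]; simpa [← Complex.ofReal_exp] using hα
    obtain ⟨v, hv⟩ := isUnit_one_sub_of_norm_lt_one hn
    set z : X := ((v⁻¹ : (X →L[ℂ] X)ˣ) : X →L[ℂ] X) y with hz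
    have hvz : z - Real.exp (-α) • 𝔄 1 z = y := by
      have h1 : ((v : X →L[ℂ] X) * ((v⁻¹ : (X →L[ℂ] X)ˣ) : X →L[ℂ] X)) y = y := by
        rw [Units.mul_inv]; rfl
      have h2 : (v : X →L[ℂ] X) z = y := h1
      rw [hv] at h2
      rw [← h2]
      simp only [sub_apply, one_apply_eq_self, smul_apply]
      congr 1
    have hm := hG.integral_mem hA α zero_le_one z
    rw [mul_one, hvz] at hm
    obtain ⟨w, hw1, hw2⟩ := (LinearPMap.mem_graph_iff A).1 hm
    refine ⟨w, ?_⟩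
    simp only at hw1 hw2 ⊢
    rw [hw2, hw1, Complex.coe_smul]
    abel

end semigroupFacts
/-! ### System nodes -/

/-- The main operator of `A&B`: `dom A = {x | (x, 0) ∈ dom A&B}` and `A x = A&B (x, 0)`. -/
def mainOp {X U : Type*} [NormedAddCommGroup X] [InnerProductSpace ℂ X]
    [NormedAddCommGroup U] [InnerProductSpace ℂ U] (AB : X × U →ₗ.[ℂ] X) : X →ₗ.[ℂ] X where
  domain := AB.domain.comap (LinearMap.inl ℂ X U)
  toFun := AB.toFun ∘ₗ (LinearMap.inl ℂ X U).restrict (fun _ hx => hx)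

theorem mem_mainOp_graph {X U : Type*} [NormedAddCommGroup X] [InnerProductSpace ℂ X]
    [NormedAddCommGroup U] [InnerProductSpace ℂ U] {AB : X × U →ₗ.[ℂ] X} {x y : X} :
    (x, y) ∈ (mainOp AB).graph ↔ ((x, (0 : U)), y) ∈ AB.graph := by
  constructor
  · intro h
    obtain ⟨w, hw1, hw2⟩ := (LinearPMap.mem_graph_iff _).1 h
    simp only at hw1 hw2
    subst hw1
    rw [← hw2]
    exact AB.mem_graph ⟨((w : X), (0 : U)), w.2⟩
  · intro h
    obtain ⟨w, hw1, hw2⟩ := (LinearPMap.mem_graph_iff _).1 h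
    simp only at hw1 hw2
    have hx : x ∈ (mainOp AB).domain := by
      change (x, (0 : U)) ∈ AB.domain
      rw [← hw1]; exact w.2
    have : (mainOp AB) ⟨x, hx⟩ = y := by
      rw [← hw2]
      exact congrArg AB (Subtype.ext hw1.symm)
    rw [← this]
    exact (mainOp AB).mem_graph ⟨x, hx⟩

/-- A system node on the triple `(X, U, Y)` of complex Hilbert spaces: a closed operator
`A&B : dom(A&B) ⊆ X × U → X` and an operator `C&D : dom(A&B) → Y`, bounded with respect to the graph
norm of `A&B`, such that each `u : U` is the second component of an element of `dom(A&B)` and the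
main operator generates a strongly continuous semigroup. -/
structure SystemNode (X U Y : Type*) [NormedAddCommGroup X] [InnerProductSpace ℂ X]
    [NormedAddCommGroup U] [InnerProductSpace ℂ U]
    [NormedAddCommGroup Y] [InnerProductSpace ℂ Y] where
  AB : X × U →ₗ.[ℂ] X
  CD : AB.domain →ₗ[ℂ] Y
  isClosed_AB : AB.IsClosed
  bounded_CD : ∃ c : ℝ, ∀ p : AB.domain, ‖CD p‖ ≤ c * (‖(p : X × U)‖ + ‖AB p‖)
  exists_state : ∀ u : U, ∃ x : X, (x, u) ∈ AB.domain
  generates : ∃ 𝔄 : ℝ → X →L[ℂ] X, IsC0Semigroup 𝔄 ∧ IsGenerator 𝔄 (mainOp AB)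

/-! ### Spaces of functions on `[0,T]` -/

/-- `L²([0,T]; E)`. -/
abbrev L2 (T : ℝ) (E : Type*) [NormedAddCommGroup E] : Type _ :=
  Lp E 2 (volume.restrict (Icc (0 : ℝ) T))

/-- The class in `L²([0,T]; E)` of a square integrable function (and `0` for other functions). -/
def toL2 (T : ℝ) {E : Type*} [NormedAddCommGroup E] (f : ℝ → E) : L2 T E :=
  open Classical in
  if h : MemLp f 2 (volume.restrict (Icc (0 : ℝ) T)) then h.toLp f else 0

theorem L2.intervalIntegrable {E : Type*} [NormedAddCommGroup E] {T : ℝ} (g : L2 T E) {a b : ℝ}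
    (ha : a ∈ Icc (0 : ℝ) T) (hb : b ∈ Icc (0 : ℝ) T) : IntervalIntegrable (fun s => g s) volume a b := by
  have h1 : IntegrableOn (fun s => g s) (Icc (0 : ℝ) T) volume :=
    (Lp.memLp g).integrable (by norm_num)
  have : uIcc a b ⊆ Icc 0 T := ordConnected_Icc.uIcc_subset ha hb
  exact (h1.mono_set this).intervalIntegrable

section functionSpaces

variable {E : Type*} [NormedAddCommGroup E] [InnerProductSpace ℂ E]

/-- The function `f : [0,T] → E` belongs to `H²_{0l}([0,T]; E)`: it has a square integrable second
(weak) derivative `f₂`, and `f` and its derivative `f₁` vanish at `0`. -/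
def MemH20l (T : ℝ) (f : ℝ → E) : Prop :=
  ∃ (f₁ : ℝ → E) (f₂ : L2 T E), ∀ t ∈ Icc (0 : ℝ) T,
    f₁ t = (∫ s in (0 : ℝ)..t, f₂ s) ∧ f t = ∫ s in (0 : ℝ)..t, f₁ s

/-- `g` is the weak derivative of `f` on `[0,T]`, and `f` vanishes at `T`. -/
def IsPrimitiveR {T : ℝ} (f g : L2 T E) : Prop :=
  ∀ᵐ t ∂(volume.restrict (Icc (0 : ℝ) T)), f t = -∫ s in t..T, g s

theorem IsPrimitiveR.add {T : ℝ} {f g f' g' : L2 T E} (h : IsPrimitiveR f g)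
    (h' : IsPrimitiveR f' g') : IsPrimitiveR (f + f') (g + g') := by
  unfold IsPrimitiveR at *
  filter_upwards [h, h', Lp.coeFn_add f f', ae_restrict_mem measurableSet_Icc] with t h1 h2 h3 ht
  have hT : T ∈ Icc (0 : ℝ) T := ⟨ht.1.trans ht.2, le_rfl⟩
  rw [h3, Pi.add_apply, h1, h2, ← neg_add, ← intervalIntegral.integral_add
    (g.intervalIntegrable ht hT) (g'.intervalIntegrable ht hT)]
  congr 1
  refine intervalIntegral.integral_congr_ae ?_
  have h4 := (ae_restrict_iff' measurableSet_Icc).1 (Lp.coeFn_add g g')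
  filter_upwards [h4] with s hs hst
  rw [uIoc_of_le ht.2] at hst
  rw [hs ⟨ht.1.trans hst.1.le, hst.2⟩, Pi.add_apply]

theorem IsPrimitiveR.smul {T : ℝ} {f g : L2 T E} (c : ℂ) (h : IsPrimitiveR f g) :
    IsPrimitiveR (c • f) (c • g) := by
  unfold IsPrimitiveR at *
  filter_upwards [h, Lp.coeFn_smul c f, ae_restrict_mem measurableSet_Icc] with t h1 h3 ht
  rw [h3, Pi.smul_apply, h1, smul_neg, ← intervalIntegral.integral_smul]
  congr 1
  refine intervalIntegral.integral_congr_ae ?_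
  have h4 := (ae_restrict_iff' measurableSet_Icc).1 (Lp.coeFn_smul c g)
  filter_upwards [h4] with s hs hst
  rw [uIoc_of_le ht.2] at hst
  rw [hs ⟨ht.1.trans hst.1.le, hst.2⟩, Pi.smul_apply]

theorem IsPrimitiveR.zero {T : ℝ} : IsPrimitiveR (0 : L2 T E) 0 := by
  simpa using (IsPrimitiveR.smul (E := E) (T := T) (f := toL2 T fun _ => 0)
    (g := toL2 T fun _ => 0) 0 (by
      have h0 : toL2 T (fun _ : ℝ => (0 : E)) = 0 := by
        unfold toL2; split_ifs with h
        · exact MemLp.toLp_zero h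
        · rfl
      rw [h0]
      unfold IsPrimitiveR
      have h4 := (ae_restrict_iff' measurableSet_Icc).1
        (Lp.coeFn_zero E 2 (volume.restrict (Icc (0 : ℝ) T)))
      filter_upwards [Lp.coeFn_zero E 2 (volume.restrict (Icc (0 : ℝ) T)),
        ae_restrict_mem measurableSet_Icc] with t h1 ht
      rw [h1, Pi.zero_apply, eq_comm, neg_eq_zero]
      refine intervalIntegral.integral_zero_ae ?_
      filter_upwards [h4] with s hs hst
      rw [uIoc_of_le ht.2] at hst
      rw [hs ⟨ht.1.trans hst.1.le, hst.2⟩, Pi.zero_apply]))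

/-- The space `H²_{0r}([0,T]; E)` of `w ∈ H²` with `w(T) = w'(T) = 0`. An element is represented by
the triple `(w, (w', w''))` in `L² × (L² × L²)`, so that the norm is (equivalent to) the `H²` norm. -/
def H20r (E : Type*) [NormedAddCommGroup E] [InnerProductSpace ℂ E] (T : ℝ) : Submodule ℂ (L2 T E × (L2 T E × L2 T E)) where
  carrier := {w | IsPrimitiveR w.1 w.2.1 ∧ IsPrimitiveR w.2.1 w.2.2}
  add_mem' h h' := ⟨h.1.add h'.1, h.2.add h'.2⟩
  zero_mem' := ⟨IsPrimitiveR.zero, IsPrimitiveR.zero⟩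
  smul_mem' c _ h := ⟨h.1.smul c, h.2.smul c⟩

/-- The space `H⁻²_{0l}([0,T]; E)`: the antidual (continuous conjugate-linear functionals) of
`H²_{0r}([0,T]; E)`. -/
abbrev Hneg20l (E : Type*) [NormedAddCommGroup E] [InnerProductSpace ℂ E] (T : ℝ) : Type _ := H20r E T →L⋆[ℂ] ℂ

/-- The embedding of `L²([0,T]; E)` into `H⁻²_{0l}([0,T]; E)` (with pivot space `L²`). -/
def ofL2 {T : ℝ} (v : L2 T E) : Hneg20l E T :=
  (innerSLFlip ℂ v).comp
    ((ContinuousLinearMap.fst ℂ (L2 T E) (L2 T E × L2 T E)).comp (H20r E T).subtypeL)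

/-- The second derivative `(d²/dt²)_l : L²([0,T]; E) → H⁻²_{0l}([0,T]; E)`,
`⟨(d²/dt²)_l v, w⟩ = ⟨v, w''⟩` for `w ∈ H²_{0r}([0,T]; E)`. -/
def secondDeriv {T : ℝ} (v : L2 T E) : Hneg20l E T :=
  (innerSLFlip ℂ v).comp
    ((ContinuousLinearMap.snd ℂ (L2 T E) (L2 T E)).comp
      ((ContinuousLinearMap.snd ℂ (L2 T E) (L2 T E × L2 T E)).comp (H20r E T).subtypeL))

theorem secondDeriv_apply {T : ℝ} (v : L2 T E) (w : H20r E T) :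
    secondDeriv v w = inner ℂ (w : L2 T E × (L2 T E × L2 T E)).2.2 v := rfl

theorem ofL2_apply {T : ℝ} (v : L2 T E) (w : H20r E T) :
    ofL2 v w = inner ℂ (w : L2 T E × (L2 T E × L2 T E)).1 v := rfl

end functionSpaces

namespace SystemNode

variable {X U Y : Type*} [NormedAddCommGroup X] [InnerProductSpace ℂ X]
  [NormedAddCommGroup U] [InnerProductSpace ℂ U] [NormedAddCommGroup Y] [InnerProductSpace ℂ Y]

/-! #### Trajectories -/

/-- Classical trajectories on `[0,T]`: `x` is continuously differentiable, `u`, `y` are continuous,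
and `x' = A&B (x, u)`, `y = C&D (x, u)` on `[0,T]`. -/
def IsClassicalTrajectory (S : SystemNode X U Y) (T : ℝ) (x : ℝ → X) (u : ℝ → U) (y : ℝ → Y) :
    Prop :=
  ContinuousOn u (Icc 0 T) ∧ ContinuousOn y (Icc 0 T) ∧
    ∃ x' : ℝ → X, ContinuousOn x' (Icc 0 T) ∧
      ∀ t ∈ Icc 0 T, HasDerivWithinAt x (x' t) (Icc 0 T) t ∧
        ∃ h : (x t, u t) ∈ S.AB.domain, x' t = S.AB ⟨(x t, u t), h⟩ ∧ y t = S.CD ⟨(x t, u t), h⟩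

/-- Generalized trajectories on `[0,T]`: limits of classical trajectories in
`C([0,T]; X) × L²([0,T]; U) × L²([0,T]; Y)`. -/
def IsGeneralizedTrajectory (S : SystemNode X U Y) {T : ℝ} (x : ℝ → X) (u : L2 T U)
    (y : L2 T Y) : Prop :=
  ∃ (xn : ℕ → ℝ → X) (un : ℕ → ℝ → U) (yn : ℕ → ℝ → Y),
    (∀ n, S.IsClassicalTrajectory T (xn n) (un n) (yn n)) ∧
    TendstoUniformlyOn xn x atTop (Icc 0 T) ∧
    Tendsto (fun n => eLpNorm (fun t => un n t - u t) 2 (volume.restrict (Icc (0 : ℝ) T)))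
      atTop (𝓝 0) ∧
    Tendsto (fun n => eLpNorm (fun t => yn n t - y t) 2 (volume.restrict (Icc (0 : ℝ) T)))
      atTop (𝓝 0)

/-! #### Main operator and semigroup -/

/-- The main operator `A`. -/
def A (S : SystemNode X U Y) : X →ₗ.[ℂ] X := mainOp S.AB

/-- The semigroup generated by the main operator. -/
def semigroup (S : SystemNode X U Y) : ℝ → X →L[ℂ] X := S.generates.choose

theorem isC0Semigroup (S : SystemNode X U Y) : IsC0Semigroup S.semigroup :=
  S.generates.choose_spec.1

theorem isGenerator (S : SystemNode X U Y) : IsGenerator S.semigroup S.A :=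
  S.generates.choose_spec.2

/-- The real numbers `α` for which `α I - A : dom A → X` is bijective. -/
def RealResolvent (S : SystemNode X U Y) : Type :=
  {α : ℝ // Function.Bijective fun x : S.A.domain => (α : ℂ) • (x : X) - S.A x}

theorem nonempty_realResolvent [CompleteSpace X] (S : SystemNode X U Y) :
    Nonempty S.RealResolvent :=
  let ⟨α, h⟩ := S.isGenerator.exists_resolvent S.isC0Semigroup
  ⟨⟨α, h⟩⟩

/-! #### The extrapolation space -/

/-- The resolvent `(α I - A)⁻¹` as a linear map. -/
def resolventLin (S : SystemNode X U Y) (α : S.RealResolvent) : X →ₗ[ℂ] X :=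
  S.A.domain.subtype ∘ₗ
    (LinearEquiv.ofBijective ((α.1 : ℂ) • S.A.domain.subtype - S.A.toFun) α.2).symm.toLinearMap

theorem mem_graph_iff_resolventLin (S : SystemNode X U Y) (α : S.RealResolvent) {x y : X} :
    (x, (α.1 : ℂ) • x - y) ∈ S.A.graph ↔ S.resolventLin α y = x := by
  set e := LinearEquiv.ofBijective ((α.1 : ℂ) • S.A.domain.subtype - S.A.toFun) α.2 with he
  have hev : ∀ w : S.A.domain, e w = (α.1 : ℂ) • (w : X) - S.A w := fun w => rfl
  have hR : S.resolventLin α y = (e.symm y : X) := rfl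
  rw [hR]
  constructor
  · intro h
    obtain ⟨w, hw1, hw2⟩ := (LinearPMap.mem_graph_iff _).1 h
    simp only at hw1 hw2
    have : e w = y := by rw [hev, hw2, hw1, sub_sub_cancel]
    rw [← this, LinearEquiv.symm_apply_apply, hw1]
  · intro h
    have h1 := hev (e.symm y)
    rw [LinearEquiv.apply_symm_apply] at h1
    have h2 : (α.1 : ℂ) • x - y = S.A (e.symm y) := by
      rw [← h]; nth_rewrite 2 [h1]; rw [sub_sub_cancel]
    rw [h2, ← h]
    exact S.A.mem_graph _

theorem isClosed_A (S : SystemNode X U Y) : _root_.IsClosed (S.A.graph : Set (X × X)) := by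
  have : (S.A.graph : Set (X × X)) =
      (fun q : X × X => ((q.1, (0 : U)), q.2)) ⁻¹' (S.AB.graph : Set ((X × U) × X)) := by
    ext ⟨x, y⟩
    exact mem_mainOp_graph
  rw [this]
  exact _root_.IsClosed.preimage (by fun_prop) S.isClosed_AB

variable [CompleteSpace X]

/-- The resolvent `(α I - A)⁻¹` as a bounded operator on `X`. -/
def resolvent (S : SystemNode X U Y) (α : S.RealResolvent) : X →L[ℂ] X :=
  ContinuousLinearMap.ofIsClosedGraph (g := S.resolventLin α) (by
    have : ((S.resolventLin α).graph : Set (X × X)) =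
        (fun q : X × X => (q.2, (α.1 : ℂ) • q.2 - q.1)) ⁻¹' (S.A.graph : Set (X × X)) := by
      ext ⟨y, x⟩
      simp only [SetLike.mem_coe, LinearMap.mem_graph_iff, mem_preimage]
      rw [S.mem_graph_iff_resolventLin α, eq_comm]
    rw [this]
    exact S.isClosed_A.preimage (by fun_prop))

theorem mem_graph_iff_resolvent (S : SystemNode X U Y) (α : S.RealResolvent) {x y : X} :
    (x, (α.1 : ℂ) • x - y) ∈ S.A.graph ↔ S.resolvent α y = x :=
  S.mem_graph_iff_resolventLin α

theorem resolvent_mem (S : SystemNode X U Y) (α : S.RealResolvent) (y : X) :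
    (S.resolvent α y, (α.1 : ℂ) • S.resolvent α y - y) ∈ S.A.graph :=
  (S.mem_graph_iff_resolvent α).2 rfl

/-- The extrapolation space `X₋₁`, i.e. the completion of `X` with respect to the norm
`‖x‖₋₁ = ‖(α I - A)⁻¹ x‖`. Since `(α I - A)⁻¹` maps `X` isometrically for this norm onto the dense
subspace `dom A` of the Hilbert space `X`, the completion is realised on (a copy of) `X`, with the
canonical embedding `X → X₋₁` given by `embed` below: an element `ξ ∈ X₋₁` is represented by the
vector `(α I - A₋₁)⁻¹ ξ ∈ X`. -/
def Extrap (S : SystemNode X U Y) (_α : S.RealResolvent) : Type _ :=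
  X

instance (S : SystemNode X U Y) (α : S.RealResolvent) : NormedAddCommGroup (S.Extrap α) :=
  inferInstanceAs (NormedAddCommGroup X)

instance (S : SystemNode X U Y) (α : S.RealResolvent) : InnerProductSpace ℂ (S.Extrap α) :=
  inferInstanceAs (InnerProductSpace ℂ X)

instance (S : SystemNode X U Y) (α : S.RealResolvent) : CompleteSpace (S.Extrap α) :=
  inferInstanceAs (CompleteSpace X)

/-- `(α I - A₋₁)⁻¹ : X₋₁ → X`, the isometry that gives the representing vector. -/
def repr (S : SystemNode X U Y) (α : S.RealResolvent) : S.Extrap α ≃ₗᵢ[ℂ] X :=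
  LinearIsometryEquiv.refl ℂ X

/-- The canonical embedding `X → X₋₁`. -/
def embed (S : SystemNode X U Y) (α : S.RealResolvent) : X →L[ℂ] S.Extrap α :=
  ((S.repr α).symm : X →L[ℂ] S.Extrap α).comp (S.resolvent α)

theorem norm_embed (S : SystemNode X U Y) (α : S.RealResolvent) (x : X) :
    ‖S.embed α x‖ = ‖S.resolvent α x‖ := rfl

theorem embed_injective (S : SystemNode X U Y) (α : S.RealResolvent) :
    Function.Injective (S.embed α) := by
  refine (injective_iff_map_eq_zero _).2 fun x hx => ?_
  have h0 : S.resolvent α x = 0 := hx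
  have h1 := S.resolvent_mem α x
  rw [h0, smul_zero, zero_sub] at h1
  exact neg_eq_zero.1 (S.A.graph_fst_eq_zero_snd h1 rfl)

theorem denseRange_embed (S : SystemNode X U Y) (α : S.RealResolvent) :
    DenseRange (S.embed α) := by
  have h : (S.A.domain : Set X) ⊆ range (S.resolvent α) := by
    intro x hx
    obtain ⟨y, hy⟩ := LinearPMap.mem_domain_iff.1 hx
    refine ⟨(α.1 : ℂ) • x - y, (S.mem_graph_iff_resolvent α).1 ?_⟩
    rwa [sub_sub_cancel]
  exact (S.isGenerator.dense_domain S.isC0Semigroup).mono h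

/-- The extension `𝔄₋₁(t)` of `𝔄(t)` to `X₋₁`; as `𝔄(t)` commutes with the resolvent, it acts on the
representing vectors in the same way as `𝔄(t)`, see `semigroupExt_embed`. -/
def semigroupExt (S : SystemNode X U Y) (α : S.RealResolvent) (t : ℝ) :
    S.Extrap α →L[ℂ] S.Extrap α :=
  ((S.repr α).symm : X →L[ℂ] S.Extrap α).comp
    ((S.semigroup t).comp ((S.repr α : S.Extrap α →L[ℂ] X)))

theorem semigroupExt_embed (S : SystemNode X U Y) (α : S.RealResolvent) {t : ℝ} (ht : 0 ≤ t)
    (x : X) : S.semigroupExt α t (S.embed α x) = S.embed α (S.semigroup t x) := by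
  have h := S.isGenerator.map_mem S.isC0Semigroup (S.resolvent_mem α x) ht
  rw [map_sub, map_smul] at h
  have h' := (S.mem_graph_iff_resolvent α).1 h
  change S.semigroup t (S.resolvent α x) = S.resolvent α (S.semigroup t x)
  rw [h']

/-- The bounded extension `A₋₁ : X → X₋₁` of the main operator, see `mainExt_apply`. -/
def mainExt (S : SystemNode X U Y) (α : S.RealResolvent) : X →L[ℂ] S.Extrap α :=
  (α.1 : ℂ) • S.embed α - ((S.repr α).symm : X →L[ℂ] S.Extrap α)

theorem mainExt_apply (S : SystemNode X U Y) (α : S.RealResolvent) {x y : X}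
    (h : (x, y) ∈ S.A.graph) : S.mainExt α x = S.embed α y := by
  have h1 : S.resolvent α ((α.1 : ℂ) • x - y) = x :=
    (S.mem_graph_iff_resolvent α).1 (by rwa [sub_sub_cancel])
  rw [map_sub, map_smul] at h1
  change (α.1 : ℂ) • S.resolvent α x - x = S.resolvent α y
  nth_rewrite 2 [← h1]
  abel

/-- On `X ⊆ X₋₁` the duality `⟨v, ξ⟩ = ⟨(α I - A*) v, (α I - A₋₁)⁻¹ ξ⟩_X` of `dom(A*)` and `X₋₁` is the inner product of `X`. -/
theorem inner_repr_embed (S : SystemNode X U Y) (α : S.RealResolvent) (v : S.A.adjoint.domain)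
    (x : X) : inner ℂ ((α.1 : ℂ) • (v : X) - S.A.adjoint v) (S.repr α (S.embed α x)) =
      inner ℂ (v : X) x := by
  have hd : Dense (S.A.domain : Set X) := S.isGenerator.dense_domain S.isC0Semigroup
  obtain ⟨w, hw1, hw2⟩ := (LinearPMap.mem_graph_iff _).1 (S.resolvent_mem α x)
  simp only at hw1 hw2
  change inner ℂ ((α.1 : ℂ) • (v : X) - S.A.adjoint v) (S.resolvent α x) = _
  have h := LinearPMap.adjoint_isFormalAdjoint hd v w
  rw [hw1, hw2] at h
  rw [inner_sub_left, h, inner_sub_right, inner_smul_left, inner_smul_right, Complex.conj_ofReal,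
    sub_sub_cancel]

/-! #### The output operator on `X₋₁ × U` -/

/-- The operator `C&D`, regarded as a partially defined operator on `X₋₁ × U` (and set to `0`
outside of its domain `dom(A&B)`). In particular `C x = C&D (x, 0)`. -/
def CDext (S : SystemNode X U Y) (α : S.RealResolvent) (p : S.Extrap α × U) : Y :=
  open Classical in
  if h : ∃ q : S.AB.domain, (S.embed α (q : X × U).1, (q : X × U).2) = p then S.CD h.choose else 0

theorem CDext_embed (S : SystemNode X U Y) (α : S.RealResolvent) (q : S.AB.domain) :
    S.CDext α (S.embed α (q : X × U).1, (q : X × U).2) = S.CD q := by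
  have h : ∃ q' : S.AB.domain, (S.embed α (q' : X × U).1, (q' : X × U).2) =
      (S.embed α (q : X × U).1, (q : X × U).2) := ⟨q, rfl⟩
  unfold CDext
  rw [dif_pos h]
  have h1 := h.choose_spec
  congr 1
  refine Subtype.ext (Prod.ext ?_ ?_)
  · exact S.embed_injective α (Prod.ext_iff.1 h1).1
  · exact (Prod.ext_iff.1 h1).2

/-! #### The control operator -/

theorem existsUnique_control (S : SystemNode X U Y) (α : S.RealResolvent) (u : U) :
    ∃! r : X, ((r, u), (α.1 : ℂ) • r) ∈ S.AB.graph := by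
  obtain ⟨x, hx⟩ := S.exists_state u
  obtain ⟨y, hy⟩ := LinearPMap.mem_domain_iff.1 hx
  have hz := mem_mainOp_graph.1 (S.resolvent_mem α (y - (α.1 : ℂ) • x))
  set z := S.resolvent α (y - (α.1 : ℂ) • x) with hzdef
  refine ⟨x + z, ?_, ?_⟩
  · have := S.AB.graph.add_mem hy hz
    convert this using 1
    refine Prod.ext (Prod.ext rfl (by simp)) ?_
    simp only [Prod.snd_add, smul_add]
    abel
  · intro r hr
    have h1 := S.AB.graph.sub_mem hr (S.AB.graph.add_mem hy hz)
    have h2 : (r - (x + z), (α.1 : ℂ) • (r - (x + z)) - 0) ∈ S.A.graph := by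
      refine mem_mainOp_graph.2 ?_
      convert h1 using 1
      refine Prod.ext (Prod.ext rfl (by simp)) ?_
      simp only [Prod.snd_add, Prod.snd_sub, smul_add, smul_sub]
      abel
    have h3 := (S.mem_graph_iff_resolvent α).1 h2
    rw [map_zero] at h3
    exact sub_eq_zero.1 h3.symm

/-- The vector `(α I - A₋₁)⁻¹ B u`: the unique `r` with `(r, u) ∈ dom(A&B)` and
`A&B (r, u) = α r`. -/
def controlLin (S : SystemNode X U Y) (α : S.RealResolvent) : U →ₗ[ℂ] X where
  toFun u := (S.existsUnique_control α u).choose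
  map_add' u v := by
    have h := (S.existsUnique_control α (u + v)).choose_spec
    refine (h.2 _ ?_).symm
    have := S.AB.graph.add_mem (S.existsUnique_control α u).choose_spec.1
      (S.existsUnique_control α v).choose_spec.1
    simpa [smul_add] using this
  map_smul' c u := by
    have h := (S.existsUnique_control α (c • u)).choose_spec
    refine (h.2 _ ?_).symm
    have := S.AB.graph.smul_mem c (S.existsUnique_control α u).choose_spec.1
    rw [Prod.smul_mk, Prod.smul_mk, smul_comm c (α.1 : ℂ)] at this
    exact this

theorem controlLin_eq_iff (S : SystemNode X U Y) (α : S.RealResolvent) {u : U} {r : X} :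
    S.controlLin α u = r ↔ ((r, u), (α.1 : ℂ) • r) ∈ S.AB.graph := by
  have h := (S.existsUnique_control α u).choose_spec
  constructor
  · rintro rfl; exact h.1
  · intro hr; exact (h.2 r hr).symm

variable [CompleteSpace U]

/-- The control operator `B ∈ L(U, X₋₁)`, characterised by `A₋₁ x + B u = A&B (x, u)`, see
`mainExt_add_control`. -/
def control (S : SystemNode X U Y) (α : S.RealResolvent) : U →L[ℂ] S.Extrap α :=
  ((S.repr α).symm : X →L[ℂ] S.Extrap α).comp
    (ContinuousLinearMap.ofIsClosedGraph (g := S.controlLin α) (by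
      have : ((S.controlLin α).graph : Set (U × X)) =
          (fun q : U × X => ((q.2, q.1), (α.1 : ℂ) • q.2)) ⁻¹'
            (S.AB.graph : Set ((X × U) × X)) := by
        ext ⟨u, r⟩
        simp only [SetLike.mem_coe, LinearMap.mem_graph_iff, mem_preimage]
        rw [← S.controlLin_eq_iff α, eq_comm]
      rw [this]
      exact _root_.IsClosed.preimage (by fun_prop) S.isClosed_AB))

theorem mainExt_add_control (S : SystemNode X U Y) (α : S.RealResolvent) (p : S.AB.domain) :
    S.mainExt α (p : X × U).1 + S.control α (p : X × U).2 = S.embed α (S.AB p) := by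
  set r := S.controlLin α (p : X × U).2 with hr
  have h1 := (S.controlLin_eq_iff α).1 hr.symm
  have h2 := S.AB.graph.sub_mem (S.AB.mem_graph p) h1
  have h3 : ((p : X × U).1 - r, S.AB p - (α.1 : ℂ) • r) ∈ S.A.graph := by
    refine mem_mainOp_graph.2 ?_
    convert h2 using 1
    refine Prod.ext (Prod.ext rfl (by simp)) rfl
  have h4 := S.mainExt_apply α h3
  have h5 : S.mainExt α r + S.control α (p : X × U).2 = S.embed α ((α.1 : ℂ) • r) := by
    rw [map_smul]
    change ((α.1 : ℂ) • S.resolvent α r - r) + r = (α.1 : ℂ) • S.resolvent α r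
    abel
  rw [map_sub, map_sub] at h4
  rw [← sub_eq_zero] at h4 h5 ⊢
  rw [← add_zero (0 : S.Extrap α)]
  nth_rewrite 1 [← h4]
  rw [← h5]
  abel

/-! #### Input and output maps -/

/-- The input-to-state map `𝔅_t u = ∫₀ᵗ 𝔄₋₁(t - s) B u(s) ds ∈ X₋₁`, for `t ∈ [0,T]`. -/
def inputToState (S : SystemNode X U Y) (α : S.RealResolvent) {T : ℝ} (t : ℝ) (u : L2 T U) :
    S.Extrap α :=
  ∫ s in (0 : ℝ)..t, S.semigroupExt α (t - s) (S.control α (u s))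

/-- The state-to-output map
`ℭ_T x₀ = (d²/dt²)_l C ∫₀^· (· - τ) 𝔄₋₁(τ) x₀ dτ ∈ H⁻²_{0l}([0,T]; Y)`. -/
def stateToOutput (S : SystemNode X U Y) (α : S.RealResolvent) (T : ℝ) (x₀ : S.Extrap α) :
    Hneg20l Y T :=
  secondDeriv (toL2 T fun t =>
    S.CDext α ((∫ τ in (0 : ℝ)..t, (t - τ) • S.semigroupExt α τ x₀), (0 : U)))

/-- The input-to-output map
`𝔇_T u = (d²/dt²)_l C&D ∫₀^· (· - τ) (𝔅_τ u, u(τ)) dτ ∈ H⁻²_{0l}([0,T]; Y)`. -/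
def inputToOutput (S : SystemNode X U Y) (α : S.RealResolvent) {T : ℝ} (u : L2 T U) :
    Hneg20l Y T :=
  secondDeriv (toL2 T fun t =>
    S.CDext α (∫ τ in (0 : ℝ)..t, (t - τ) • ((S.inputToState α τ u, u τ) : S.Extrap α × U)))

/-- `ℭ_T x₀ + 𝔇_T u` belongs to `L²([0,T]; Y)` and is equal to `y`. -/
def IsOutput (S : SystemNode X U Y) (α : S.RealResolvent) {T : ℝ} (x₀ : S.Extrap α) (u : L2 T U)
    (y : L2 T Y) : Prop :=
  S.stateToOutput α T x₀ + S.inputToOutput α u = ofL2 y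

/-! #### The terminal value map -/

section terminal

variable {Z : Type*} [NormedAddCommGroup Z] [InnerProductSpace ℂ Z]

/-- The operator `B* : dom(A*) → U` adjoint to `B ∈ L(U, X₋₁)` with respect to the duality
`⟨v, ξ⟩ = ⟨(α I - A*) v, (α I - A₋₁)⁻¹ ξ⟩_X` of `dom(A*)` and `X₋₁` (pivot space `X`). -/
def controlAdj (S : SystemNode X U Y) (α : S.RealResolvent) (v : S.A.adjoint.domain) : U :=
  ContinuousLinearMap.adjoint ((S.repr α : S.Extrap α →L[ℂ] X).comp (S.control α))
    ((α.1 : ℂ) • (v : X) - S.A.adjoint v)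

/-- The set `𝓑_F` of all `w ∈ Z` such that `B* ∫₀^· (· - τ) 𝔄(τ)* F* w dτ ∈ H²_{0l}([0,T]; U)`. -/
def setB [CompleteSpace Z] (S : SystemNode X U Y) (α : S.RealResolvent) (T : ℝ) (F : X →L[ℂ] Z) :
    Set Z :=
  {w | ∃ v : ℝ → S.A.adjoint.domain,
    (∀ t ∈ Icc (0 : ℝ) T, (v t : X) = ∫ τ in (0 : ℝ)..t,
      (t - τ) • ContinuousLinearMap.adjoint (S.semigroup τ) (ContinuousLinearMap.adjoint F w)) ∧
    MemH20l T fun t => S.controlAdj α (v t)}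

/-- The graph of the `F`-terminal value map `𝔗_{F,T}`, the closure with respect to `u` of
`(x₀, u) ↦ F (𝔄₋₁(T) x₀ + 𝔅_T u)`, defined where `𝔄₋₁(T) x₀ + 𝔅_T u ∈ X`. Thus
`S.IsTerminalValue α F x₀ u z` means that `(x₀, u) ∈ dom 𝔗_{F,T}` with `𝔗_{F,T} (x₀, u) = z`.
The closure is kept as a relation, so that no single-valuedness has to be presupposed. -/
def IsTerminalValue (S : SystemNode X U Y) (α : S.RealResolvent) {T : ℝ} (F : X →L[ℂ] Z)
    (x₀ : S.Extrap α) (u : L2 T U) (z : Z) : Prop :=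
  ∃ (un : ℕ → L2 T U) (xn : ℕ → X),
    Tendsto un atTop (𝓝 u) ∧
    (∀ n, S.semigroupExt α T x₀ + S.inputToState α T (un n) = S.embed α (xn n)) ∧
    Tendsto (fun n => F (xn n)) atTop (𝓝 z)

/-- The reachable set `𝓡_F` of all values `𝔗_{F,T} (0, u)`. -/
def reachable (S : SystemNode X U Y) (α : S.RealResolvent) (T : ℝ) (F : X →L[ℂ] Z) : Set Z :=
  {z | ∃ u : L2 T U, S.IsTerminalValue α F 0 u z}

/-! #### The optimal control problem -/

/-- The cost `½ ‖𝔗_{F,T} (x₀, u) - z_f‖² + ½ ‖ℭ_T x₀ + 𝔇_T u - y_ref‖²` of the input `u`, equal to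
`∞` if `(x₀, u) ∉ dom 𝔗_{F,T}` or `ℭ_T x₀ + 𝔇_T u ∉ L²`. It is written as an infimum over the values
`z` of `𝔗_{F,T} (x₀, u)` and `y` of `ℭ_T x₀ + 𝔇_T u`, see `cost_eq` and `cost_eq_top`. -/
def cost (S : SystemNode X U Y) (α : S.RealResolvent) {T : ℝ} (F : X →L[ℂ] Z)
    (x₀ : S.Extrap α) (zf : Z) (yref : L2 T Y) (u : L2 T U) : ℝ≥0∞ :=
  ⨅ (z : Z) (y : L2 T Y) (_ : S.IsTerminalValue α F x₀ u z) (_ : S.IsOutput α x₀ u y),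
    ENNReal.ofReal (1 / 2 * (‖z - zf‖ ^ 2 + ‖y - yref‖ ^ 2))

theorem cost_eq (S : SystemNode X U Y) (α : S.RealResolvent) {T : ℝ} (F : X →L[ℂ] Z)
    (x₀ : S.Extrap α) (zf : Z) (yref : L2 T Y) (u : L2 T U) {z : Z} {y : L2 T Y}
    (hz : S.IsTerminalValue α F x₀ u z) (hy : S.IsOutput α x₀ u y)
    (hz' : ∀ z', S.IsTerminalValue α F x₀ u z' → z' = z)
    (hy' : ∀ y', S.IsOutput α x₀ u y' → y' = y) :
    S.cost α F x₀ zf yref u = ENNReal.ofReal (1 / 2 * (‖z - zf‖ ^ 2 + ‖y - yref‖ ^ 2)) := by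
  unfold cost
  refine le_antisymm (iInf_le_of_le z (iInf_le_of_le y (iInf_le_of_le hz (iInf_le _ hy)))) ?_
  refine le_iInf fun z' => le_iInf fun y' => le_iInf fun h1 => le_iInf fun h2 => ?_
  rw [hz' z' h1, hy' y' h2]

theorem cost_eq_top (S : SystemNode X U Y) (α : S.RealResolvent) {T : ℝ} (F : X →L[ℂ] Z)
    (x₀ : S.Extrap α) (zf : Z) (yref : L2 T Y) (u : L2 T U)
    (h : (¬ ∃ z, S.IsTerminalValue α F x₀ u z) ∨ ¬ ∃ y, S.IsOutput α x₀ u y) :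
    S.cost α F x₀ zf yref u = ∞ := by
  unfold cost
  simp only [iInf_eq_top]
  intro z y hz hy
  rcases h with h | h
  · exact (h ⟨z, hz⟩).elim
  · exact (h ⟨y, hy⟩).elim

/-- The reduced admissible set: the `u ∈ 𝓤_ad` with `(x₀, u) ∈ dom 𝔗_{F,T}` and
`𝔗_{F_c,T} (x₀, u) = z_c`. -/
def reducedAdmissible {Zc : Type*} [NormedAddCommGroup Zc] [InnerProductSpace ℂ Zc]
    (S : SystemNode X U Y) (α : S.RealResolvent) {T : ℝ} (F : X →L[ℂ] Z) (Fc : X →L[ℂ] Zc)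
    (x₀ : S.Extrap α) (zc : Zc) (Uad : Set (L2 T U)) : Set (L2 T U) :=
  {u | u ∈ Uad ∧ (∃ z, S.IsTerminalValue α F x₀ u z) ∧ S.IsTerminalValue α Fc x₀ u zc}

/-- Coercivity along generalized trajectories:
`‖y‖²_{L²} + ‖F x(T)‖ ≥ c ‖u‖²_{L²}` whenever `x(0) = 0`. -/
def CoerciveOnTrajectories (S : SystemNode X U Y) (T : ℝ) (F : X →L[ℂ] Z) : Prop :=
  ∃ c : ℝ, 0 < c ∧ ∀ (x : ℝ → X) (u : L2 T U) (y : L2 T Y),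
    S.IsGeneralizedTrajectory x u y → x 0 = 0 → c * ‖u‖ ^ 2 ≤ ‖y‖ ^ 2 + ‖F (x T)‖

/-- Coercivity of the quadratic part of the cost functional on its whole domain:
`‖𝔇_T u‖²_{L²} + ‖𝔗_{F,T} (0, u)‖² ≥ c ‖u‖²_{L²}` for all `u` with `(0, u) ∈ dom 𝔗_{F,T}` and
`𝔇_T u ∈ L²`. -/
def CoerciveOnDomain (S : SystemNode X U Y) (α : S.RealResolvent) (T : ℝ) (F : X →L[ℂ] Z) : Prop :=
  ∃ c : ℝ, 0 < c ∧ ∀ (u : L2 T U) (z : Z) (y : L2 T Y),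
    S.IsTerminalValue α F 0 u z → S.inputToOutput α u = ofL2 y →
      c * ‖u‖ ^ 2 ≤ ‖y‖ ^ 2 + ‖z‖ ^ 2

end terminal

end SystemNode
end SysNode
end

/-! ### Iterated integrals over a triangle -/

noncomputable section

namespace SysNode

/-! The cost is half the squared distance of the pair (terminal value, output) to `(zf, yref)` in
the Hilbert space `Z × L²`. So the problem is to minimise a distance over the set `G` of all `(u,
(z, y))` in which `u` is admissible, `z` is a terminal value of `u`, `zc` is a constrained terminal
value of `u`, and `y` is its output. The values `z` and `y` are carried along as separate
coordinates, so `G` is a set in a Hilbert space and no single-valuedness enters.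

`G` is closed and midpoint-convex. The terminal value relation at a fixed initial state is a closure
by definition (`isClosed_isTerminalValue`). The output relation is closed because the unbounded map
`𝔇_T` is the second derivative of a bounded operator `outputCLM`: integrating the trajectory twice
brings it into the domain of `A&B` (`state₂_mem_graph`), where `C&D` is controlled by the graph norm
(`isClosed_isOutput`). A distance to a point attains its infimum over such a set provided that its
sublevel sets are bounded in `u` as well (`exists_forall_norm_sub_le`). This is proved by nested
closed sets and the parallelogram law, in place of weak compactness.

Boundedness of the sublevel sets is immediate if the admissible set is bounded. Under coercivity on
the domain, it follows by applying the estimate to differences with one feasible input, since the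
initial state cancels. Coercivity along trajectories is reduced to that case. There the terminal
value has power one while the other terms are quadratic, so scaling a trajectory removes it and
leaves `c ‖u‖² ≤ ‖y‖²` for classical trajectories starting at zero. To reach every input with square
integrable output, the input is extended by zero to negative times and averaged twice over backward
windows. Such averages are second differences of the twice integrated trajectory, hence belong to
classical trajectories, and their outputs are the averages of `y` (`exists_classical_backAvg`).
Averaging is a contraction of `L²(-∞, T)`, and letting the windows shrink, with Lebesgue
differentiation and Fatou, gives the estimate for `u` (`CoerciveOnTrajectories.le_output`). -/

theorem integral_triangle_swap {E : Type*} [NormedAddCommGroup E] [NormedSpace ℝ E]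
    {K : ℝ → ℝ → E} {t : ℝ} (ht : 0 ≤ t)
    (hK : Integrable (Function.uncurry K)
      ((volume.restrict (Ioc 0 t)).prod (volume.restrict (Ioc 0 t)))) :
    IntervalIntegrable (fun s => ∫ τ in s..t, K τ s) volume 0 t ∧
    ∫ τ in (0 : ℝ)..t, ∫ s in (0 : ℝ)..τ, K τ s = ∫ s in (0 : ℝ)..t, ∫ τ in s..t, K τ s := by
  -- Cutting the kernel off above the diagonal turns both iterated integrals into integrals over the
  -- full square, where Fubini applies.
  set G : ℝ → ℝ → E := fun τ s => (Iic τ).indicator (K τ) s with hG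
  have hGi : Integrable (Function.uncurry G)
      ((volume.restrict (Ioc 0 t)).prod (volume.restrict (Ioc 0 t))) := by
    have hm : MeasurableSet {q : ℝ × ℝ | q.2 ≤ q.1} := measurableSet_le measurable_snd measurable_fst
    refine (hK.indicator hm).congr (Eventually.of_forall fun q => ?_)
    simp [hG, Function.uncurry, indicator]
  have e1 : ∀ τ ∈ Ioc 0 t, ∫ s in (0 : ℝ)..τ, K τ s = ∫ s in Ioc 0 t, G τ s := fun τ hτ => by
    simp only [hG]
    rw [intervalIntegral.integral_of_le hτ.1.le, setIntegral_indicator measurableSet_Iic]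
    congr 2
    ext s
    simp only [mem_inter_iff, mem_Ioc, mem_Iic]
    exact ⟨fun h => ⟨⟨h.1, h.2.trans hτ.2⟩, h.2⟩, fun h => ⟨h.1.1, h.2⟩⟩
  have e2 : ∀ s ∈ Ioc 0 t, ∫ τ in Ioc 0 t, G τ s = ∫ τ in s..t, K τ s := fun s hs => by
    have e : ∀ τ, G τ s = (Ici s).indicator (fun τ => K τ s) τ := fun τ => by
      simp [hG, indicator]
    simp only [e]
    rw [intervalIntegral.integral_of_le hs.2, setIntegral_indicator measurableSet_Ici,
      ← integral_Icc_eq_integral_Ioc]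
    congr 2
    ext τ
    simp only [mem_inter_iff, mem_Ioc, mem_Ici, mem_Icc]
    exact ⟨fun h => ⟨h.2, h.1.2⟩, fun h => ⟨⟨hs.1.trans_le h.1, h.2⟩, h.1⟩⟩
  refine ⟨?_, ?_⟩
  · rw [intervalIntegrable_iff_integrableOn_Ioc_of_le ht]
    refine hGi.integral_prod_right.congr ?_
    filter_upwards [ae_restrict_mem measurableSet_Ioc] with s hs using e2 s hs
  · rw [intervalIntegral.integral_of_le ht, intervalIntegral.integral_of_le ht,
      setIntegral_congr_fun measurableSet_Ioc e1, integral_integral_swap hGi]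
    exact setIntegral_congr_fun measurableSet_Ioc e2

/-- Cauchy's formula for repeated integration. -/
theorem integral_sub_smul {E : Type*} [NormedAddCommGroup E] [NormedSpace ℝ E] [CompleteSpace E]
    {f : ℝ → E} {t : ℝ} (ht : 0 ≤ t) (hf : IntervalIntegrable f volume 0 t) :
    ∫ τ in (0 : ℝ)..t, (t - τ) • f τ = ∫ τ in (0 : ℝ)..t, ∫ s in (0 : ℝ)..τ, f s := by
  have hi : Integrable (Function.uncurry fun _ s : ℝ => f s)
      ((volume.restrict (Ioc 0 t)).prod (volume.restrict (Ioc 0 t))) := by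
    have h1 := (intervalIntegrable_iff_integrableOn_Ioc_of_le ht).1 hf
    exact h1.integrable.comp_snd _
  rw [(integral_triangle_swap ht hi).2]
  simp

/-- The backward primitive is adjoint to the forward primitive. -/
theorem integral_inner_primitive {E : Type*} [NormedAddCommGroup E] [InnerProductSpace ℂ E]
    [CompleteSpace E] {f g : ℝ → E} {T : ℝ} (hT : 0 ≤ T) (hf : IntervalIntegrable f volume 0 T)
    (hg : IntervalIntegrable g volume 0 T) :
    ∫ t in (0 : ℝ)..T, inner ℂ (g t) (∫ s in (0 : ℝ)..t, f s) =
      ∫ s in (0 : ℝ)..T, inner ℂ (∫ t in s..T, g t) (f s) := by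
  have hf' := ((intervalIntegrable_iff_integrableOn_Ioc_of_le hT).1 hf).integrable
  have hg' := ((intervalIntegrable_iff_integrableOn_Ioc_of_le hT).1 hg).integrable
  have hi : Integrable (Function.uncurry fun t s : ℝ => inner ℂ (g t) (f s))
      ((volume.restrict (Ioc 0 T)).prod (volume.restrict (Ioc 0 T))) := by
    refine (hg'.norm.mul_prod hf'.norm).mono'
      ((hg'.aestronglyMeasurable.comp_fst).inner (hf'.aestronglyMeasurable.comp_snd))
      (Eventually.of_forall fun q => norm_inner_le_norm _ _)
  have h := (integral_triangle_swap hT hi).2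
  rw [intervalIntegral.integral_of_le hT, intervalIntegral.integral_of_le hT] at h ⊢
  have sub1 : ∀ t ∈ Ioc 0 T, IntervalIntegrable f volume 0 t := fun t ht =>
    hf.mono_set (by rw [uIcc_of_le ht.1.le, uIcc_of_le hT]; exact Icc_subset_Icc_right ht.2)
  have sub2 : ∀ t ∈ Ioc 0 T, IntervalIntegrable g volume t T := fun t ht =>
    hg.mono_set (by rw [uIcc_of_le ht.2, uIcc_of_le hT]; exact Icc_subset_Icc_left ht.1.le)
  calc _ = ∫ t in Ioc 0 T, ∫ s in (0 : ℝ)..t, inner ℂ (g t) (f s) := by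
        refine setIntegral_congr_fun measurableSet_Ioc fun t ht => ?_
        exact ((innerSL ℂ (g t)).intervalIntegral_comp_comm (sub1 t ht)).symm
    _ = _ := h
    _ = _ := by
        refine setIntegral_congr_fun measurableSet_Ioc fun s hs => ?_
        rw [← inner_conj_symm, ← innerSL_apply_apply ℂ,
          ← (innerSL ℂ (f s)).intervalIntegral_comp_comm (sub2 s hs),
          intervalIntegral.integral_of_le hs.2, intervalIntegral.integral_of_le hs.2,
          ← integral_conj]
        simp only [innerSL_apply_apply, inner_conj_symm]

/-! ### Primitives of `L²` functions and the distributional second derivative -/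

theorem toL2_coeFn {E : Type*} [NormedAddCommGroup E] {T : ℝ} {f : ℝ → E}
    (hf : MemLp f 2 (volume.restrict (Icc (0 : ℝ) T))) :
    toL2 T f =ᵐ[volume.restrict (Icc (0 : ℝ) T)] f := by
  unfold toL2
  rw [dif_pos hf]
  exact hf.coeFn_toLp

theorem memLp_of_continuousOn {E : Type*} [NormedAddCommGroup E] {T : ℝ} {f : ℝ → E}
    (hf : ContinuousOn f (Icc 0 T)) : MemLp f 2 (volume.restrict (Icc (0 : ℝ) T)) := by
  obtain ⟨C, hC⟩ := isCompact_Icc.exists_bound_of_continuousOn hf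
  refine MemLp.of_bound (hf.aestronglyMeasurable_of_isCompact isCompact_Icc measurableSet_Icc) C ?_
  filter_upwards [ae_restrict_mem measurableSet_Icc] with t ht using hC t ht

theorem L2.continuousOn_primitive {E : Type*} [NormedAddCommGroup E] [NormedSpace ℝ E] {T : ℝ}
    (g : L2 T E) : ContinuousOn (fun t => ∫ s in (0 : ℝ)..t, g s) (Icc 0 T) := by
  rcases le_total 0 T with hT | hT
  · have h0 := g.intervalIntegrable (left_mem_Icc.2 hT) (right_mem_Icc.2 hT)
    have := intervalIntegral.continuousOn_primitive_interval' h0 left_mem_uIcc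
    rwa [uIcc_of_le hT] at this
  · exact (continuousOn_singleton (fun t => ∫ s in (0 : ℝ)..t, g s) 0).mono
      fun t ht => le_antisymm (ht.2.trans hT) ht.1

theorem L2.continuousOn_backward {E : Type*} [NormedAddCommGroup E] [NormedSpace ℝ E] {T : ℝ}
    (hT : 0 ≤ T) (g : L2 T E) : ContinuousOn (fun t => -∫ s in t..T, g s) (Icc 0 T) := by
  refine (g.continuousOn_primitive.sub (continuousOn_const (c := ∫ s in (0 : ℝ)..T, g s))).congr
    fun t ht => ?_
  have h0 := g.intervalIntegrable (left_mem_Icc.2 hT) ht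
  have h1 := g.intervalIntegrable ht (right_mem_Icc.2 hT)
  rw [← intervalIntegral.integral_add_adjacent_intervals h0 h1]
  simp

theorem L2.exists_isPrimitiveR {E : Type*} [NormedAddCommGroup E] [InnerProductSpace ℂ E] {T : ℝ}
    (hT : 0 ≤ T) (g : L2 T E) : ∃ f : L2 T E, IsPrimitiveR f g :=
  ⟨toL2 T fun t => -∫ s in t..T, g s, toL2_coeFn (memLp_of_continuousOn (g.continuousOn_backward hT))⟩

/-- Integration by parts: `f` vanishes at `T` and the forward primitive of `y` at `0`, so there are
no boundary terms. -/
theorem IsPrimitiveR.inner_eq {E : Type*} [NormedAddCommGroup E] [InnerProductSpace ℂ E]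
    [CompleteSpace E] {T : ℝ} (hT : 0 ≤ T) {f g : L2 T E} (h : IsPrimitiveR f g) (y : L2 T E) :
    inner ℂ f y = -inner ℂ g (toL2 T fun t => ∫ s in (0 : ℝ)..t, y s) := by
  have h1 := toL2_coeFn (memLp_of_continuousOn y.continuousOn_primitive)
  have h0 := left_mem_Icc.2 hT
  have h2 := right_mem_Icc.2 hT
  have e1 : inner ℂ f y = ∫ t in (0 : ℝ)..T, inner ℂ (-∫ s in t..T, g s) (y t) := by
    rw [MeasureTheory.L2.inner_def, intervalIntegral.integral_of_le hT,
      ← integral_Icc_eq_integral_Ioc]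
    refine integral_congr_ae ?_
    filter_upwards [h] with t ht
    rw [ht]
  have e2 : inner ℂ g (toL2 T fun t => ∫ s in (0 : ℝ)..t, y s) =
      ∫ t in (0 : ℝ)..T, inner ℂ (g t) (∫ s in (0 : ℝ)..t, y s) := by
    rw [MeasureTheory.L2.inner_def, intervalIntegral.integral_of_le hT,
      ← integral_Icc_eq_integral_Ioc]
    refine integral_congr_ae ?_
    filter_upwards [h1] with t ht
    rw [ht]
  rw [e1, e2, integral_inner_primitive hT (y.intervalIntegrable h0 h2)
    (g.intervalIntegrable h0 h2), ← intervalIntegral.integral_neg]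
  simp only [inner_neg_left]

/-- If `(d²/dt²)_l v` is the class of `y ∈ L²`, then `v` is the twofold primitive of `y`. -/
theorem eq_primitive_of_secondDeriv_eq_ofL2 {E : Type*} [NormedAddCommGroup E]
    [InnerProductSpace ℂ E] [CompleteSpace E] {T : ℝ} (hT : 0 ≤ T) {v y : L2 T E}
    (h : secondDeriv v = ofL2 y) :
    ∀ᵐ t ∂(volume.restrict (Icc (0 : ℝ) T)),
      v t = ∫ s in (0 : ℝ)..t, ∫ r in (0 : ℝ)..s, y r := by
  set y₁ : L2 T E := toL2 T fun t => ∫ s in (0 : ℝ)..t, y s with hy₁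
  set y₂ : L2 T E := toL2 T fun t => ∫ s in (0 : ℝ)..t, y₁ s with hy₂
  have key : v = y₂ := by
    -- Every `g ∈ L²` is the second derivative of an element of `H20r`, obtained by integrating
    -- twice backwards from `T`. Hence testing against `H20r` tests `v` against all of `L²`.
    refine ext_inner_left ℂ fun g => ?_
    obtain ⟨g₁, hg₁⟩ := g.exists_isPrimitiveR hT
    obtain ⟨g₀, hg₀⟩ := g₁.exists_isPrimitiveR hT
    have h1 := congrArg (fun φ : Hneg20l E T => φ ⟨(g₀, (g₁, g)), hg₀, hg₁⟩) h
    simp only [secondDeriv_apply, ofL2_apply] at h1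
    rw [h1, hg₀.inner_eq hT, hg₁.inner_eq hT, neg_neg]
  have h1 := toL2_coeFn (memLp_of_continuousOn y.continuousOn_primitive)
  have h2 := toL2_coeFn (memLp_of_continuousOn y₁.continuousOn_primitive)
  rw [key]
  filter_upwards [h2, ae_restrict_mem measurableSet_Icc] with t ht htT
  rw [ht]
  refine intervalIntegral.integral_congr_ae ?_
  filter_upwards [(ae_restrict_iff' measurableSet_Icc).1 h1] with s hs hst
  rw [uIoc_of_le htT.1] at hst
  exact hs ⟨hst.1.le, hst.2.trans htT.2⟩

/-! ### Backward averages -/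

theorem intervalIntegrable_of_locallyIntegrable {E : Type*} [NormedAddCommGroup E] {f : ℝ → E}
    (hf : LocallyIntegrable f) (a b : ℝ) : IntervalIntegrable f volume a b :=
  (hf.integrableOn_isCompact isCompact_uIcc).intervalIntegrable

/-- The average of `f` over `[t - h, t]`. -/
def backAvg {E : Type*} [NormedAddCommGroup E] [NormedSpace ℝ E] (h : ℝ) (f : ℝ → E) (t : ℝ) : E :=
  h⁻¹ • ∫ s in (t - h)..t, f s

theorem backAvg_eq {E : Type*} [NormedAddCommGroup E] [NormedSpace ℝ E] {f : ℝ → E}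
    (hf : LocallyIntegrable f) (h t : ℝ) :
    backAvg h f t = h⁻¹ • ((∫ s in (0 : ℝ)..t, f s) - ∫ s in (0 : ℝ)..(t - h), f s) := by
  have hi := intervalIntegrable_of_locallyIntegrable hf
  rw [backAvg, intervalIntegral.integral_interval_sub_left (hi _ _) (hi _ _)]

theorem continuous_backAvg {E : Type*} [NormedAddCommGroup E] [NormedSpace ℝ E] {f : ℝ → E}
    (hf : LocallyIntegrable f) (h : ℝ) : Continuous (backAvg h f) := by
  have hc := intervalIntegral.continuous_primitive (intervalIntegrable_of_locallyIntegrable hf) 0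
  have : backAvg h f = fun t =>
      h⁻¹ • ((∫ s in (0 : ℝ)..t, f s) - ∫ s in (0 : ℝ)..(t - h), f s) :=
    funext fun t => backAvg_eq hf h t
  rw [this]
  exact (hc.sub (hc.comp (continuous_id.sub continuous_const))).const_smul _

/-- This is how averages of a rough input are reached from its twofold primitive, and thus from the
twice integrated trajectory. -/
theorem backAvg_backAvg {E : Type*} [NormedAddCommGroup E] [NormedSpace ℝ E] {f : ℝ → E}
    (hf : LocallyIntegrable f) (h k t : ℝ) :
    backAvg h (backAvg k f) t = (h⁻¹ * k⁻¹) •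
      ((∫ s in (0 : ℝ)..t, ∫ r in (0 : ℝ)..s, f r) - (∫ s in (0 : ℝ)..(t - k), ∫ r in (0 : ℝ)..s, f r)
       - ((∫ s in (0 : ℝ)..(t - h), ∫ r in (0 : ℝ)..s, f r)
        - ∫ s in (0 : ℝ)..(t - h - k), ∫ r in (0 : ℝ)..s, f r)) := by
  have hc := intervalIntegral.continuous_primitive (intervalIntegrable_of_locallyIntegrable hf) 0
  set f₁ : ℝ → E := fun s => ∫ r in (0 : ℝ)..s, f r with hf₁
  have hi : ∀ a b, IntervalIntegrable f₁ volume a b := fun a b => hc.intervalIntegrable _ _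
  have hi' : ∀ a b, IntervalIntegrable (fun s => f₁ (s - k)) volume a b := fun a b =>
    (hc.comp (continuous_id.sub continuous_const)).intervalIntegrable _ _
  have e : ∀ s, backAvg k f s = k⁻¹ • (f₁ s - f₁ (s - k)) := fun s => backAvg_eq hf k s
  unfold backAvg at e ⊢
  simp only [e]
  rw [intervalIntegral.integral_smul, intervalIntegral.integral_sub (hi _ _) (hi' _ _),
    intervalIntegral.integral_comp_sub_right, smul_smul,
    ← intervalIntegral.integral_interval_sub_left (hi 0 t) (hi 0 (t - h)),
    ← intervalIntegral.integral_interval_sub_left (hi 0 (t - k)) (hi 0 (t - h - k))]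
  congr 1
  abel

/-- Cauchy–Schwarz against the constant `1`, after moving the window to the fixed interval `(0, h]`
so that Tonelli can be used afterwards. -/
theorem enorm_backAvg_sq_le {E : Type*} [NormedAddCommGroup E] [NormedSpace ℝ E] {f : ℝ → E}
    (hf : AEStronglyMeasurable f) {h : ℝ} (hh : 0 < h) (t : ℝ) :
    ‖backAvg h f t‖ₑ ^ 2 ≤ (ENNReal.ofReal h)⁻¹ * ∫⁻ s in Ioc 0 h, ‖f (t - s)‖ₑ ^ 2 := by
  set a := ENNReal.ofReal h with ha
  have ha0 : a ≠ 0 := by simpa [ha] using hh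
  have hat : a ≠ ∞ := ENNReal.ofReal_ne_top
  have e1 : (∫ s in (t - h)..t, f s) = ∫ s in Ioc 0 h, f (t - s) := by
    rw [← intervalIntegral.integral_of_le hh.le, intervalIntegral.integral_comp_sub_left, sub_zero]
  have hft : AEMeasurable (fun s => ‖f (t - s)‖ₑ) (volume.restrict (Ioc 0 h)) := by
    have : AEStronglyMeasurable (fun s => f (t - s)) volume :=
      hf.comp_quasiMeasurePreserving
        (Measure.measurePreserving_sub_left volume t).quasiMeasurePreserving
    exact this.restrict.enorm
  have h1 : ‖∫ s in Ioc 0 h, f (t - s)‖ₑ ≤ ∫⁻ s in Ioc 0 h, ‖f (t - s)‖ₑ :=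
    enorm_integral_le_lintegral_enorm _
  have h2 : (∫⁻ s in Ioc 0 h, ‖f (t - s)‖ₑ) ^ 2 ≤ a * ∫⁻ s in Ioc 0 h, ‖f (t - s)‖ₑ ^ 2 := by
    have := ENNReal.lintegral_mul_le_Lp_mul_Lq (volume.restrict (Ioc 0 h))
      Real.HolderConjugate.two_two (f := fun _ => 1) (g := fun s => ‖f (t - s)‖ₑ)
      aemeasurable_const hft
    simp only [Pi.mul_apply, one_mul, lintegral_const, Measure.restrict_apply,
      MeasurableSet.univ, univ_inter, Real.volume_Ioc, sub_zero, ENNReal.rpow_two] at this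
    calc _ ≤ _ := pow_le_pow_left' this 2
      _ = _ := by
        have e : ∀ b : ℝ≥0∞, (b ^ (1 / 2 : ℝ)) ^ 2 = b := fun b => by
          rw [← ENNReal.rpow_two, ← ENNReal.rpow_mul]; norm_num
        rw [mul_pow, e, e, one_pow, one_mul]
  have e2 : ‖backAvg h f t‖ₑ = a⁻¹ * ‖∫ s in Ioc 0 h, f (t - s)‖ₑ := by
    rw [backAvg, enorm_smul, e1, enorm_inv hh.ne', Real.enorm_of_nonneg hh.le]
  rw [e2, mul_pow]
  calc _ ≤ a⁻¹ ^ 2 * (a * ∫⁻ s in Ioc 0 h, ‖f (t - s)‖ₑ ^ 2) := by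
        gcongr; exact (pow_le_pow_left' h1 2).trans h2
    _ = _ := by
        rw [← mul_assoc, sq, mul_assoc a⁻¹ a⁻¹ a, ENNReal.inv_mul_cancel ha0 hat, mul_one]

/-- Backward averaging is a contraction in `L²(-∞, T)`. -/
theorem lintegral_backAvg_le {E : Type*} [NormedAddCommGroup E] [NormedSpace ℝ E] {f : ℝ → E}
    (hf : AEStronglyMeasurable f) {h : ℝ} (hh : 0 < h) (T : ℝ) :
    ∫⁻ t in Iic T, ‖backAvg h f t‖ₑ ^ 2 ≤ ∫⁻ t in Iic T, ‖f t‖ₑ ^ 2 := by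
  set a := ENNReal.ofReal h with ha
  have ha0 : a ≠ 0 := by simpa [ha] using hh
  have hat : a ≠ ∞ := ENNReal.ofReal_ne_top
  have hm : AEMeasurable (Function.uncurry fun t s : ℝ => ‖f (t - s)‖ₑ ^ 2)
      ((volume.restrict (Iic T)).prod (volume.restrict (Ioc 0 h))) := by
    have h1 : AEStronglyMeasurable (fun q : ℝ × ℝ => f (q.1 - q.2)) (volume.prod volume) :=
      hf.comp_quasiMeasurePreserving (quasiMeasurePreserving_sub volume volume)
    have h2 : AEMeasurable (fun q : ℝ × ℝ => ‖f (q.1 - q.2)‖ₑ ^ 2) (volume.prod volume) :=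
      h1.enorm.pow_const 2
    rw [Measure.prod_restrict]
    exact h2.restrict
  calc _ ≤ ∫⁻ t in Iic T, a⁻¹ * ∫⁻ s in Ioc 0 h, ‖f (t - s)‖ₑ ^ 2 :=
        lintegral_mono fun t => enorm_backAvg_sq_le hf hh t
    _ = a⁻¹ * ∫⁻ t in Iic T, ∫⁻ s in Ioc 0 h, ‖f (t - s)‖ₑ ^ 2 :=
        lintegral_const_mul' _ _ (ENNReal.inv_ne_top.2 ha0)
    _ = a⁻¹ * ∫⁻ s in Ioc 0 h, ∫⁻ t in Iic T, ‖f (t - s)‖ₑ ^ 2 := by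
        rw [lintegral_lintegral_swap hm]
    _ ≤ a⁻¹ * ∫⁻ s in Ioc 0 h, ∫⁻ t in Iic T, ‖f t‖ₑ ^ 2 := by
        gcongr a⁻¹ * ?_
        -- Delaying by `s > 0` replaces the half-line up to `T` by the smaller one up to `T - s`.
        -- This is why the windows look backwards and the estimate lives on a half-line.
        refine setLIntegral_mono' measurableSet_Ioc fun s hs => ?_
        have e : ∫⁻ t in Iic T, ‖f (t - s)‖ₑ ^ 2 = ∫⁻ t in Iic (T - s), ‖f t‖ₑ ^ 2 := by
          have := (measurePreserving_sub_right volume s).setLIntegral_comp_preimage_emb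
            (MeasurableEquiv.subRight s).measurableEmbedding (fun t => ‖f t‖ₑ ^ 2) (Iic (T - s))
          rw [← this]
          congr 2
          ext t; simp
        rw [e]
        exact lintegral_mono_set (Iic_subset_Iic.2 (by linarith [hs.1]))
    _ = _ := by
        rw [lintegral_const, Measure.restrict_apply MeasurableSet.univ, univ_inter, Real.volume_Ioc,
          sub_zero, mul_comm _ a, ← mul_assoc, ENNReal.inv_mul_cancel ha0 hat, one_mul]

/-- A backward average is a left difference quotient of the primitive, so Lebesgue differentiation
applies. -/
theorem ae_tendsto_backAvg {E : Type*} [NormedAddCommGroup E] [NormedSpace ℝ E] [CompleteSpace E]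
    {f : ℝ → E} (hf : LocallyIntegrable f) :
    ∀ᵐ t, Tendsto (fun h => backAvg h f t) (𝓝[>] 0) (𝓝 (f t)) := by
  filter_upwards [_root_.LocallyIntegrable.ae_hasDerivAt_integral hf] with t ht
  have h1 := (ht 0).tendsto_slope_zero_left
  have h2 : Tendsto (fun h : ℝ => -h) (𝓝[>] 0) (𝓝[<] 0) := by
    refine tendsto_nhdsWithin_iff.2 ⟨?_, ?_⟩
    · simpa using (tendsto_id.neg : Tendsto (fun h : ℝ => -h) (𝓝 0) _).mono_left
        (nhdsWithin_le_nhds (s := Ioi 0))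
    · filter_upwards [self_mem_nhdsWithin] with h hh
      simpa using hh
  refine (h1.comp h2).congr fun h => ?_
  simp only [Function.comp]
  rw [backAvg_eq hf, inv_neg, neg_smul, ← smul_neg, neg_sub, ← sub_eq_add_neg]

/-- Lower semicontinuity of the `L²` norm under backward averaging. -/
theorem lintegral_le_of_backAvg {E : Type*} [NormedAddCommGroup E] [NormedSpace ℝ E]
    [CompleteSpace E] {f : ℝ → E} (hf : LocallyIntegrable f) {T : ℝ} {K c : ℝ≥0∞}
    (h : ∀ h > 0, c * ∫⁻ t in Icc 0 T, ‖backAvg h f t‖ₑ ^ 2 ≤ K) (hc : c ≠ ∞) :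
    c * ∫⁻ t in Icc 0 T, ‖f t‖ₑ ^ 2 ≤ K := by
  have hn : Tendsto (fun n : ℕ => 1 / ((n : ℝ) + 1)) atTop (𝓝[>] 0) :=
    tendsto_nhdsWithin_iff.2 ⟨tendsto_one_div_add_atTop_nhds_zero_nat,
      Eventually.of_forall fun n => by simp only [mem_Ioi]; positivity⟩
  rw [← lintegral_const_mul' _ _ hc]
  -- Fatou's lemma along the window lengths `1/(n+1)`.
  calc _ ≤ ∫⁻ t in Icc 0 T, liminf
          (fun n : ℕ => c * ‖backAvg (1 / ((n : ℝ) + 1)) f t‖ₑ ^ 2) atTop := by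
        refine lintegral_mono_ae ((ae_restrict_of_ae (ae_tendsto_backAvg hf)).mono fun t ht => ?_)
        have h1 : Tendsto (fun n : ℕ => c * ‖backAvg (1 / ((n : ℝ) + 1)) f t‖ₑ ^ 2) atTop
            (𝓝 (c * ‖f t‖ₑ ^ 2)) :=
          ENNReal.Tendsto.const_mul ((ENNReal.continuous_pow 2).continuousAt.tendsto.comp
            ((continuous_enorm.tendsto _).comp (ht.comp hn))) (Or.inr hc)
        exact h1.liminf_eq.ge
    _ ≤ liminf (fun n : ℕ => ∫⁻ t in Icc 0 T, c * ‖backAvg (1 / ((n : ℝ) + 1)) f t‖ₑ ^ 2) atTop := by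
        refine lintegral_liminf_le' fun n => ?_
        exact (((continuous_backAvg hf _).enorm.measurable.pow_const 2).const_mul c).aemeasurable
    _ ≤ K := by
        refine liminf_le_of_le (by isBoundedDefault) fun b hb => ?_
        obtain ⟨n, hn⟩ := hb.exists
        refine hn.trans ?_
        rw [lintegral_const_mul' _ _ hc]
        exact h _ (by positivity)

end SysNode

namespace SysNode

/-! ### Convolution with a strongly continuous semigroup -/

section semigroupConvolution

variable {X : Type*} [NormedAddCommGroup X] [NormedSpace ℂ X]
  {𝔄 : ℝ → X →L[ℂ] X} {A : X →ₗ.[ℂ] X}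

/-- Orbits are bounded on compact time intervals; the uniform boundedness principle does the rest.
-/
theorem IsC0Semigroup.exists_bound [CompleteSpace X] (hA : IsC0Semigroup 𝔄) (T : ℝ) :
    ∃ M : ℝ, 0 ≤ M ∧ ∀ t ∈ Icc 0 T, ‖𝔄 t‖ ≤ M := by
  obtain ⟨M, hM⟩ := banach_steinhaus (g := fun t : Icc (0 : ℝ) T => 𝔄 t) fun x => by
    obtain ⟨C, hC⟩ := isCompact_Icc.exists_bound_of_continuousOn
      ((hA.cont x).mono (fun t ht => ht.1 : Icc (0 : ℝ) T ⊆ Ici 0))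
    exact ⟨C, fun t => hC t t.2⟩
  exact ⟨max M 0, le_max_right _ _, fun t ht => (hM ⟨t, ht⟩).trans (le_max_left _ _)⟩

/-- The semigroup, frozen outside of `[0,T]`. -/
def truncSemigroup (𝔄 : ℝ → X →L[ℂ] X) (T t : ℝ) : X →L[ℂ] X :=
  𝔄 (max 0 (min t T))

theorem truncSemigroup_eq {T t : ℝ} (ht : t ∈ Icc 0 T) : truncSemigroup 𝔄 T t = 𝔄 t := by
  rw [truncSemigroup, min_eq_left ht.2, max_eq_right ht.1]

theorem IsC0Semigroup.exists_bound_trunc [CompleteSpace X] (hA : IsC0Semigroup 𝔄) {T : ℝ}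
    (hT : 0 ≤ T) : ∃ M : ℝ, 0 ≤ M ∧ ∀ t, ‖truncSemigroup 𝔄 T t‖ ≤ M := by
  obtain ⟨M, hM0, hM⟩ := hA.exists_bound T
  exact ⟨M, hM0, fun t => hM _ ⟨le_max_left _ _, max_le hT (min_le_right _ _)⟩⟩

theorem IsC0Semigroup.continuous_trunc_apply (hA : IsC0Semigroup 𝔄) (T : ℝ) (x : X) :
    Continuous fun t => truncSemigroup 𝔄 T t x :=
  (hA.cont x).comp_continuous (f := fun t : ℝ => max 0 (min t T)) (by fun_prop)
    (fun _ => mem_Ici.2 (le_max_left _ _))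

/-- Strong continuity and a uniform operator bound give joint continuity. This yields measurability
of `s ↦ 𝔄(t - s) f(s)` when `f` is merely measurable; freezing the semigroup makes the bound hold at
all times. -/
theorem IsC0Semigroup.continuous_trunc [CompleteSpace X] (hA : IsC0Semigroup 𝔄) {T : ℝ}
    (hT : 0 ≤ T) : Continuous fun q : ℝ × X => truncSemigroup 𝔄 T q.1 q.2 := by
  obtain ⟨M, hM0, hM⟩ := hA.exists_bound_trunc hT
  refine continuous_iff_continuousAt.2 fun ⟨t₀, x₀⟩ => ?_
  have h1 : Tendsto (fun q : ℝ × X => truncSemigroup 𝔄 T q.1 x₀) (𝓝 (t₀, x₀))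
      (𝓝 (truncSemigroup 𝔄 T t₀ x₀)) :=
    ((hA.continuous_trunc_apply T x₀).comp continuous_fst).tendsto (t₀, x₀)
  have h2 : Tendsto (fun q : ℝ × X => truncSemigroup 𝔄 T q.1 (q.2 - x₀)) (𝓝 (t₀, x₀)) (𝓝 0) := by
    have h3 : Tendsto (fun q : ℝ × X => M * ‖q.2 - x₀‖) (𝓝 (t₀, x₀)) (𝓝 0) := by
      have : Continuous fun q : ℝ × X => M * ‖q.2 - x₀‖ := by fun_prop
      simpa using this.tendsto (t₀, x₀)
    exact squeeze_zero_norm (fun q => (truncSemigroup 𝔄 T q.1).le_of_opNorm_le (hM q.1) _) h3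
  have := h2.add h1
  rw [zero_add] at this
  refine this.congr fun q => ?_
  rw [map_sub, sub_add_cancel]

/-- The convolution `∫₀ᵗ 𝔄(t - s) f(s) ds` for `t ∈ [0,T]`. -/
def semigroupConv (𝔄 : ℝ → X →L[ℂ] X) (T : ℝ) (f : ℝ → X) (t : ℝ) : X :=
  ∫ s in (0 : ℝ)..t, truncSemigroup 𝔄 T (t - s) (f s)

theorem semigroupConv_norm_le {M T : ℝ} (hM0 : 0 ≤ M) (hM : ∀ t, ‖truncSemigroup 𝔄 T t‖ ≤ M)
    {f : ℝ → X} (hf : LocallyIntegrable f) {t : ℝ} (ht : t ∈ Icc 0 T) :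
    ‖semigroupConv 𝔄 T f t‖ ≤ M * ∫ s in (0 : ℝ)..T, ‖f s‖ := by
  have hi := intervalIntegrable_of_locallyIntegrable hf
  calc _ ≤ ∫ s in (0 : ℝ)..t, M * ‖f s‖ :=
        intervalIntegral.norm_integral_le_of_norm_le ht.1
          (Eventually.of_forall fun s _ => (truncSemigroup 𝔄 T (t - s)).le_of_opNorm_le (hM _) _)
          ((hi _ _).norm.const_mul M)
    _ = M * ∫ s in (0 : ℝ)..t, ‖f s‖ := intervalIntegral.integral_const_mul _ _
    _ ≤ _ := by
        gcongr
        exact intervalIntegral.integral_mono_interval le_rfl ht.1 ht.2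
          (Eventually.of_forall fun s => norm_nonneg _) (hi _ _).norm

variable [CompleteSpace X]

theorem IsC0Semigroup.intervalIntegrable_conv (hA : IsC0Semigroup 𝔄) {T : ℝ} (hT : 0 ≤ T)
    {f : ℝ → X} {a b : ℝ} (hf : IntervalIntegrable f volume a b) (t : ℝ) :
    IntervalIntegrable (fun s => truncSemigroup 𝔄 T (t - s) (f s)) volume a b := by
  obtain ⟨M, hM0, hM⟩ := hA.exists_bound_trunc hT
  refine (hf.norm.const_mul M).mono_fun' ?_
    (Eventually.of_forall fun s => (truncSemigroup 𝔄 T (t - s)).le_of_opNorm_le (hM _) _)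
  exact (hA.continuous_trunc hT).comp_aestronglyMeasurable
    ((by fun_prop : Measurable fun s : ℝ => t - s).aestronglyMeasurable.prodMk
      (intervalIntegrable_iff.1 hf).aestronglyMeasurable)

theorem IsC0Semigroup.continuous_conv (hA : IsC0Semigroup 𝔄) {T : ℝ} (hT : 0 ≤ T)
    {f : ℝ → X} (hf : LocallyIntegrable f) : Continuous (semigroupConv 𝔄 T f) := by
  obtain ⟨M, hM0, hM⟩ := hA.exists_bound_trunc hT
  have hi := intervalIntegrable_of_locallyIntegrable hf
  refine continuous_iff_continuousAt.2 fun t₀ => ?_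
  -- The time `t` enters both the integrand and the upper limit. The two are treated as independent
  -- variables, with dominating function `M * ‖f s‖` on a window around `0` and `t₀`, and the result
  -- is restricted to the diagonal.
  have h := intervalIntegral.continuousAt_parametric_primitive_of_dominated (μ := volume)
    (F := fun t s => truncSemigroup 𝔄 T (t - s) (f s)) (x₀ := t₀) (a₀ := 0) (b₀ := t₀)
    (fun s => M * ‖f s‖) (-|t₀| - 1) (|t₀| + 1)
    (fun t => (intervalIntegrable_iff.1 (hA.intervalIntegrable_conv hT (hi _ _) t)).aestronglyMeasurable)
    (Eventually.of_forall fun t => Eventually.of_forall fun s =>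
      (truncSemigroup 𝔄 T (t - s)).le_of_opNorm_le (hM _) _)
    ((hi _ _).norm.const_mul M)
    (Eventually.of_forall fun s =>
      ((hA.continuous_trunc_apply T (f s)).comp (continuous_id.sub continuous_const)).continuousAt)
    ⟨by linarith [abs_nonneg t₀], by linarith [abs_nonneg t₀]⟩
    ⟨by linarith [neg_abs_le t₀], by linarith [le_abs_self t₀]⟩ (by simp)
  exact ContinuousAt.comp (f := fun t : ℝ => (t, t))
    (g := fun p : ℝ × ℝ => ∫ s in (0 : ℝ)..p.2, truncSemigroup 𝔄 T (p.1 - s) (f s)) h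
    (by fun_prop)

/-- `∫₀ᵗ (𝔄 * f)` lies in the domain of the generator, and `A ∫₀ᵗ (𝔄 * f) = (𝔄 * f)(t) - ∫₀ᵗ f`;
written in terms of a resolvent `R = (α - A)⁻¹`. -/
theorem IsGenerator.resolvent_conv (hA : IsC0Semigroup 𝔄) (hG : IsGenerator 𝔄 A) {α : ℝ}
    {R : X →L[ℂ] X} (hR : ∀ x y, (x, (α : ℂ) • x - y) ∈ A.graph ↔ R y = x) {T : ℝ}
    {f : ℝ → X} (hf : LocallyIntegrable f) {t : ℝ} (ht : t ∈ Icc 0 T) :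
    R ((α : ℂ) • (∫ τ in (0 : ℝ)..t, semigroupConv 𝔄 T f τ) - semigroupConv 𝔄 T f t
      + ∫ s in (0 : ℝ)..t, f s) = ∫ τ in (0 : ℝ)..t, semigroupConv 𝔄 T f τ := by
  have hT : 0 ≤ T := ht.1.trans ht.2
  obtain ⟨M, hM0, hM⟩ := hA.exists_bound_trunc hT
  have hi := intervalIntegrable_of_locallyIntegrable hf
  have hK : Integrable (Function.uncurry fun τ s => truncSemigroup 𝔄 T (τ - s) (f s))
      ((volume.restrict (Ioc 0 t)).prod (volume.restrict (Ioc 0 t))) := by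
    have hf' : Integrable f (volume.restrict (Ioc 0 t)) :=
      (intervalIntegrable_iff_integrableOn_Ioc_of_le ht.1).1 (hi 0 t)
    have hb : Integrable (fun q : ℝ × ℝ => M * ‖f q.2‖)
        ((volume.restrict (Ioc 0 t)).prod (volume.restrict (Ioc 0 t))) :=
      (hf'.norm.comp_snd _).const_mul M
    refine hb.mono' ?_ (Eventually.of_forall fun q =>
      (truncSemigroup 𝔄 T (q.1 - q.2)).le_of_opNorm_le (hM _) _)
    exact (hA.continuous_trunc hT).comp_aestronglyMeasurable
      ((by fun_prop : Measurable fun q : ℝ × ℝ => q.1 - q.2).aestronglyMeasurable.prodMk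
        hf'.aestronglyMeasurable.comp_snd)
  obtain ⟨hSi, hS⟩ := integral_triangle_swap ht.1 hK
  have hS' : ∫ τ in (0 : ℝ)..t, semigroupConv 𝔄 T f τ =
      ∫ s in (0 : ℝ)..t, ∫ τ in s..t, truncSemigroup 𝔄 T (τ - s) (f s) := hS
  -- For a single vector `f s` this is `A ∫₀^{t-s} 𝔄(r) x dr = 𝔄(t-s) x - x`, the case of exponent
  -- `0` in `IsGenerator.integral_mem`. In resolvent form only the bounded operator `R` has to be
  -- moved through the integral over `s`.
  have hpt : ∀ s ∈ uIcc 0 t, R ((α : ℂ) • (∫ τ in s..t, truncSemigroup 𝔄 T (τ - s) (f s))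
      - truncSemigroup 𝔄 T (t - s) (f s) + f s) =
        ∫ τ in s..t, truncSemigroup 𝔄 T (τ - s) (f s) := by
    intro s hs
    rw [uIcc_of_le ht.1] at hs
    have hts : 0 ≤ t - s := sub_nonneg.2 hs.2
    have hm := hG.integral_mem hA 0 hts (f s)
    simp only [zero_mul, neg_zero, Real.exp_zero, one_smul, zero_smul, zero_sub, neg_sub] at hm
    have e1 : ∫ τ in s..t, truncSemigroup 𝔄 T (τ - s) (f s) =
        ∫ r in (0 : ℝ)..(t - s), 𝔄 (max r 0) (f s) := by
      rw [intervalIntegral.integral_comp_sub_right (fun r => truncSemigroup 𝔄 T r (f s)), sub_self]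
      refine intervalIntegral.integral_congr fun r hr => ?_
      rw [uIcc_of_le hts] at hr
      rw [truncSemigroup_eq ⟨hr.1, by linarith [hr.2, hs.1, ht.2]⟩, max_eq_left hr.1]
    rw [truncSemigroup_eq ⟨hts, by linarith [hs.1, ht.2]⟩, e1, ← hR]
    convert hm using 2
    abel
  rw [hS', semigroupConv]
  have i1 := hA.intervalIntegrable_conv hT (hi 0 t) t
  have i2 : IntervalIntegrable
      (fun s => (α : ℂ) • ∫ τ in s..t, truncSemigroup 𝔄 T (τ - s) (f s)) volume 0 t := hSi.smul _
  rw [← intervalIntegral.integral_smul, ← intervalIntegral.integral_sub i2 i1,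
    ← intervalIntegral.integral_add (i2.sub i1) (hi 0 t),
    ← R.intervalIntegral_comp_comm ((i2.sub i1).add (hi 0 t))]
  exact intervalIntegral.integral_congr hpt

end semigroupConvolution

end SysNode

namespace SysNode

namespace SystemNode

variable {X U Y : Type*} [NormedAddCommGroup X] [InnerProductSpace ℂ X]
  [NormedAddCommGroup U] [InnerProductSpace ℂ U] [NormedAddCommGroup Y] [InnerProductSpace ℂ Y]

theorem mem_domain_of_graph (S : SystemNode X U Y) {x : X} {u : U} {x' : X}
    (h : ((x, u), x') ∈ S.AB.graph) : (x, u) ∈ S.AB.domain :=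
  LinearPMap.mem_domain_of_mem_graph h

variable [CompleteSpace X]

/-! ### The output operator on the graph of `A&B` -/

theorem CDext_eq_CD (S : SystemNode X U Y) (α : S.RealResolvent) {x : X} {u : U}
    (h : (x, u) ∈ S.AB.domain) : S.CDext α (S.embed α x, u) = S.CD ⟨(x, u), h⟩ :=
  S.CDext_embed α ⟨(x, u), h⟩

theorem CDext_add (S : SystemNode X U Y) (α : S.RealResolvent) {x x' : X} {u u' : U}
    (h : (x, u) ∈ S.AB.domain) (h' : (x', u') ∈ S.AB.domain) :
    S.CDext α (S.embed α (x + x'), u + u') =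
      S.CDext α (S.embed α x, u) + S.CDext α (S.embed α x', u') := by
  rw [S.CDext_eq_CD α h, S.CDext_eq_CD α h', ← map_add]
  exact S.CDext_eq_CD α (S.AB.domain.add_mem h h')

theorem CDext_smul (S : SystemNode X U Y) (α : S.RealResolvent) {x : X} {u : U} (c : ℂ)
    (h : (x, u) ∈ S.AB.domain) :
    S.CDext α (S.embed α (c • x), c • u) = c • S.CDext α (S.embed α x, u) := by
  rw [S.CDext_eq_CD α h, ← map_smul]
  exact S.CDext_eq_CD α (S.AB.domain.smul_mem c h)

theorem CDext_sub (S : SystemNode X U Y) (α : S.RealResolvent) {x x' : X} {u u' : U}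
    (h : (x, u) ∈ S.AB.domain) (h' : (x', u') ∈ S.AB.domain) :
    S.CDext α (S.embed α (x - x'), u - u') =
      S.CDext α (S.embed α x, u) - S.CDext α (S.embed α x', u') := by
  rw [S.CDext_eq_CD α h, S.CDext_eq_CD α h', ← map_sub]
  exact S.CDext_eq_CD α (S.AB.domain.sub_mem h h')

theorem exists_bound_CDext (S : SystemNode X U Y) (α : S.RealResolvent) :
    ∃ c : ℝ, 0 ≤ c ∧ ∀ x u x', ((x, u), x') ∈ S.AB.graph →
      ‖S.CDext α (S.embed α x, u)‖ ≤ c * (‖x‖ + ‖u‖ + ‖x'‖) := by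
  obtain ⟨c, hc⟩ := S.bounded_CD
  -- The constant in `bounded_CD` carries no sign.
  refine ⟨max c 0, le_max_right _ _, fun x u x' h => ?_⟩
  obtain ⟨w, hw1, hw2⟩ := (LinearPMap.mem_graph_iff _).1 h
  simp only at hw1 hw2
  have hd : (x, u) ∈ S.AB.domain := hw1 ▸ w.2
  rw [S.CDext_eq_CD α hd]
  have hw : w = ⟨(x, u), hd⟩ := Subtype.ext hw1
  have := hc ⟨(x, u), hd⟩
  rw [← hw, hw2, hw1] at this
  rw [← hw]
  refine this.trans ?_
  have h1 : ‖((x, u) : X × U)‖ ≤ ‖x‖ + ‖u‖ :=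
    max_le (le_add_of_nonneg_right (norm_nonneg _)) (le_add_of_nonneg_left (norm_nonneg _))
  gcongr
  exact le_max_left _ _

/-- The graph of `A&B` is linear, so the graph norm bound on `C&D` can be applied to differences of
its values along the curve. -/
theorem continuousOn_CDext (S : SystemNode X U Y) (α : S.RealResolvent) {s : Set ℝ}
    {x x' : ℝ → X} {u : ℝ → U} (hx : ContinuousOn x s) (hx' : ContinuousOn x' s)
    (hu : ContinuousOn u s) (h : ∀ t ∈ s, ((x t, u t), x' t) ∈ S.AB.graph) :
    ContinuousOn (fun t => S.CDext α (S.embed α (x t), u t)) s := by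
  obtain ⟨c, hc0, hc⟩ := S.exists_bound_CDext α
  intro t₀ ht₀
  refine tendsto_iff_norm_sub_tendsto_zero.2 ?_
  have hlim : Tendsto (fun t => c * (‖x t - x t₀‖ + ‖u t - u t₀‖ + ‖x' t - x' t₀‖))
      (𝓝[s] t₀) (𝓝 0) := by
    have h1 := tendsto_iff_norm_sub_tendsto_zero.1 (hx t₀ ht₀)
    have h2 := tendsto_iff_norm_sub_tendsto_zero.1 (hu t₀ ht₀)
    have h3 := tendsto_iff_norm_sub_tendsto_zero.1 (hx' t₀ ht₀)
    simpa using ((h1.add h2).add h3).const_mul c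
  refine squeeze_zero' (Eventually.of_forall fun t => norm_nonneg _) ?_ hlim
  filter_upwards [self_mem_nhdsWithin] with t ht
  rw [← S.CDext_sub α (S.mem_domain_of_graph (h t ht)) (S.mem_domain_of_graph (h t₀ ht₀))]
  exact hc _ _ _ (S.AB.graph.sub_mem (h t ht) (h t₀ ht₀))

theorem isClassicalTrajectory_of_graph (S : SystemNode X U Y) (α : S.RealResolvent) {T : ℝ}
    {x x' : ℝ → X} {u : ℝ → U} (hx : ∀ t, HasDerivAt x (x' t) t)
    (hx' : Continuous x') (hu : Continuous u)
    (h : ∀ t ∈ Icc 0 T, ((x t, u t), x' t) ∈ S.AB.graph) :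
    S.IsClassicalTrajectory T x u fun t => S.CDext α (S.embed α (x t), u t) := by
  have hxc : Continuous x := continuous_iff_continuousAt.2 fun t => (hx t).continuousAt
  refine ⟨hu.continuousOn, S.continuousOn_CDext α hxc.continuousOn hx'.continuousOn
    hu.continuousOn h, x', hx'.continuousOn, fun t ht => ⟨(hx t).hasDerivWithinAt, ?_⟩⟩
  have hd := S.mem_domain_of_graph (h t ht)
  refine ⟨hd, ?_, S.CDext_eq_CD α hd⟩
  exact LinearPMap.mem_graph_snd_inj' S.AB (h t ht) (S.AB.mem_graph ⟨(x t, u t), hd⟩) rfl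

/-! ### Integrated trajectories with initial state zero -/

variable [CompleteSpace U]

/-- The bounded operator `(α I - A₋₁)⁻¹ B : U → X`. -/
def reprControl (S : SystemNode X U Y) (α : S.RealResolvent) : U →L[ℂ] X :=
  (S.repr α : S.Extrap α →L[ℂ] X).comp (S.control α)

theorem reprControl_mem (S : SystemNode X U Y) (α : S.RealResolvent) (u : U) :
    ((S.reprControl α u, u), (α.1 : ℂ) • S.reprControl α u) ∈ S.AB.graph :=
  (S.controlLin_eq_iff α).1 rfl

/-- The vector `(α I - A₋₁)⁻¹ 𝔅_t f`. -/
def stateR (S : SystemNode X U Y) (α : S.RealResolvent) (T : ℝ) (f : ℝ → U) : ℝ → X :=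
  semigroupConv S.semigroup T fun s => S.reprControl α (f s)

/-- The integrated state `∫₀ᵗ 𝔅_τ f dτ ∈ X`. -/
def state₁ (S : SystemNode X U Y) (α : S.RealResolvent) (T : ℝ) (f : ℝ → U) (t : ℝ) : X :=
  (α.1 : ℂ) • (∫ τ in (0 : ℝ)..t, S.stateR α T f τ) - S.stateR α T f t
    + S.reprControl α (∫ τ in (0 : ℝ)..t, f τ)

/-- The twice integrated state `∫₀ᵗ (t - τ) 𝔅_τ f dτ ∈ X`. -/
def state₂ (S : SystemNode X U Y) (α : S.RealResolvent) (T : ℝ) (f : ℝ → U) (t : ℝ) : X :=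
  ∫ τ in (0 : ℝ)..t, S.state₁ α T f τ

/-- The twofold primitive. -/
def prim₂ {E : Type*} [NormedAddCommGroup E] [NormedSpace ℝ E] (f : ℝ → E) (t : ℝ) : E :=
  ∫ τ in (0 : ℝ)..t, ∫ s in (0 : ℝ)..τ, f s

theorem locallyIntegrable_reprControl (S : SystemNode X U Y) (α : S.RealResolvent) {f : ℝ → U}
    (hf : LocallyIntegrable f) : LocallyIntegrable fun s => S.reprControl α (f s) := fun t =>
  let ⟨s, hs, hfs⟩ := hf t
  ⟨s, hs, (S.reprControl α).integrable_comp hfs⟩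

theorem continuous_stateR (S : SystemNode X U Y) (α : S.RealResolvent) {T : ℝ} (hT : 0 ≤ T)
    {f : ℝ → U} (hf : LocallyIntegrable f) : Continuous (S.stateR α T f) :=
  S.isC0Semigroup.continuous_conv hT (S.locallyIntegrable_reprControl α hf)

theorem continuous_prim {E : Type*} [NormedAddCommGroup E] [NormedSpace ℝ E] {f : ℝ → E}
    (hf : LocallyIntegrable f) : Continuous fun t => ∫ s in (0 : ℝ)..t, f s :=
  intervalIntegral.continuous_primitive (intervalIntegrable_of_locallyIntegrable hf) 0

theorem continuous_prim₂ {E : Type*} [NormedAddCommGroup E] [NormedSpace ℝ E] {f : ℝ → E}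
    (hf : LocallyIntegrable f) : Continuous (prim₂ f) :=
  continuous_prim (continuous_prim hf).locallyIntegrable

theorem continuous_state₁ (S : SystemNode X U Y) (α : S.RealResolvent) {T : ℝ} (hT : 0 ≤ T)
    {f : ℝ → U} (hf : LocallyIntegrable f) : Continuous (S.state₁ α T f) := by
  have h1 := S.continuous_stateR α hT hf
  exact (((continuous_prim h1.locallyIntegrable).const_smul (α.1 : ℂ)).sub h1).add
    ((S.reprControl α).continuous.comp (continuous_prim hf))

theorem hasDerivAt_state₂ (S : SystemNode X U Y) (α : S.RealResolvent) {T : ℝ} (hT : 0 ≤ T)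
    {f : ℝ → U} (hf : LocallyIntegrable f) (t : ℝ) :
    HasDerivAt (S.state₂ α T f) (S.state₁ α T f t) t :=
  ((S.continuous_state₁ α hT hf).integral_hasStrictDerivAt 0 t).hasDerivAt

/-- This justifies the formula defining `state₁`: its image in `X₋₁` is the integral of the
`X₋₁`-valued state. One integration in time thus brings the state back into `X`. -/
theorem resolvent_state₁ (S : SystemNode X U Y) (α : S.RealResolvent) {T : ℝ}
    {f : ℝ → U} (hf : LocallyIntegrable f) {t : ℝ} (ht : t ∈ Icc 0 T) :
    S.resolvent α (S.state₁ α T f t) = ∫ τ in (0 : ℝ)..t, S.stateR α T f τ := by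
  have h := S.isGenerator.resolvent_conv S.isC0Semigroup (α := α.1) (R := S.resolvent α)
    (fun x y => S.mem_graph_iff_resolvent α) (S.locallyIntegrable_reprControl α hf) ht
  rw [(S.reprControl α).intervalIntegral_comp_comm
    (intervalIntegrable_of_locallyIntegrable hf 0 t)] at h
  exact h

theorem resolvent_state₂ (S : SystemNode X U Y) (α : S.RealResolvent) {T : ℝ}
    {f : ℝ → U} (hf : LocallyIntegrable f) {t : ℝ} (ht : t ∈ Icc 0 T) :
    S.resolvent α (S.state₂ α T f t) = prim₂ (S.stateR α T f) t := by
  have hT := ht.1.trans ht.2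
  rw [state₂, ← (S.resolvent α).intervalIntegral_comp_comm
    ((S.continuous_state₁ α hT hf).intervalIntegrable _ _)]
  refine intervalIntegral.integral_congr fun τ hτ => ?_
  rw [uIcc_of_le ht.1] at hτ
  exact S.resolvent_state₁ α hf ⟨hτ.1, hτ.2.trans ht.2⟩

theorem state₂_eq (S : SystemNode X U Y) (α : S.RealResolvent) {T : ℝ} (hT : 0 ≤ T)
    {f : ℝ → U} (hf : LocallyIntegrable f) (t : ℝ) :
    S.state₂ α T f t = (α.1 : ℂ) • prim₂ (S.stateR α T f) t
      - (∫ τ in (0 : ℝ)..t, S.stateR α T f τ) + S.reprControl α (prim₂ f t) := by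
  have h1 := S.continuous_stateR α hT hf
  have h2 := continuous_prim h1.locallyIntegrable
  have h3 := continuous_prim hf
  have i1 : IntervalIntegrable (fun τ => (α.1 : ℂ) • ∫ s in (0 : ℝ)..τ, S.stateR α T f s) volume 0 t :=
    (h2.const_smul (α.1 : ℂ)).intervalIntegrable 0 t
  have i2 := h1.intervalIntegrable (μ := volume) 0 t
  have i3 : IntervalIntegrable (fun τ => S.reprControl α (∫ s in (0 : ℝ)..τ, f s)) volume 0 t :=
    ((S.reprControl α).continuous.comp h3).intervalIntegrable 0 t
  simp only [state₂, state₁, prim₂]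
  rw [intervalIntegral.integral_add (i1.sub i2) i3, intervalIntegral.integral_sub i1 i2,
    intervalIntegral.integral_smul, (S.reprControl α).intervalIntegral_comp_comm
      (h3.intervalIntegrable (μ := volume) 0 t)]

/-- With `state₁` the derivative of `state₂`, this is the differential equation of the twice
integrated trajectory. By `state₂_eq`, the state splits into `reprControl` applied to the twice
integrated input and a remainder. The remainder lies in `dom A`, since it combines values of the
resolvent at `state₂` and `state₁`. -/
theorem state₂_mem_graph (S : SystemNode X U Y) (α : S.RealResolvent) {T : ℝ}
    {f : ℝ → U} (hf : LocallyIntegrable f) {t : ℝ} (ht : t ∈ Icc 0 T) :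
    ((S.state₂ α T f t, prim₂ f t), S.state₁ α T f t) ∈ S.AB.graph := by
  have h1 := (S.mem_graph_iff_resolvent α).2 (S.resolvent_state₁ α hf ht)
  have h2 := (S.mem_graph_iff_resolvent α).2 (S.resolvent_state₂ α hf ht)
  have h3 := mem_mainOp_graph.1 (S.A.graph.sub_mem (S.A.graph.smul_mem (α.1 : ℂ) h2) h1)
  have h4 := S.AB.graph.add_mem h3 (S.reprControl_mem α (prim₂ f t))
  convert h4 using 1
  refine Prod.ext (Prod.ext ?_ (by simp)) ?_
  · exact S.state₂_eq α (ht.1.trans ht.2) hf t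
  · simp only [Prod.snd_add, Prod.smul_snd]
    rw [S.state₂_eq α (ht.1.trans ht.2) hf t]
    simp only [smul_sub, smul_add]
    abel

theorem prim_eq_zero {E : Type*} [NormedAddCommGroup E] [NormedSpace ℝ E] {f : ℝ → E}
    (hf : ∀ t < 0, f t = 0) {t : ℝ} (ht : t ≤ 0) : ∫ s in (0 : ℝ)..t, f s = 0 := by
  refine (intervalIntegral.integral_congr_ae ?_).trans intervalIntegral.integral_zero
  -- Nothing is known about `f 0`, so the point `0` is discarded as a null set.
  filter_upwards [compl_mem_ae_iff.2 (measure_singleton (0 : ℝ))] with s hs hst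
  rw [uIoc_of_ge ht] at hst
  exact hf s (lt_of_le_of_ne hst.2 hs)

theorem prim₂_eq_zero {E : Type*} [NormedAddCommGroup E] [NormedSpace ℝ E] {f : ℝ → E}
    (hf : ∀ t < 0, f t = 0) {t : ℝ} (ht : t ≤ 0) : prim₂ f t = 0 :=
  prim_eq_zero (fun _ hs => prim_eq_zero hf hs.le) ht

theorem stateR_eq_zero (S : SystemNode X U Y) (α : S.RealResolvent) {T : ℝ}
    {f : ℝ → U} (hf : ∀ t < 0, f t = 0) {t : ℝ} (ht : t ≤ 0) : S.stateR α T f t = 0 := by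
  refine prim_eq_zero (fun s hs => ?_) ht
  simp [hf s hs]

theorem state_eq_zero (S : SystemNode X U Y) (α : S.RealResolvent) {T : ℝ}
    {f : ℝ → U} (hf : ∀ t < 0, f t = 0) {t : ℝ} (ht : t ≤ 0) :
    state₁ S α T f t = 0 ∧ state₂ S α T f t = 0 ∧ prim₂ f t = 0 := by
  have h1 : ∀ t ≤ 0, S.state₁ α T f t = 0 := fun t ht => by
    rw [state₁, prim_eq_zero (fun s hs => S.stateR_eq_zero α hf hs.le) ht,
      S.stateR_eq_zero α hf ht, prim_eq_zero hf ht]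
    simp
  exact ⟨h1 t ht, prim_eq_zero (fun s hs => h1 s hs.le) ht, prim₂_eq_zero hf ht⟩

/-- Backward differences at times near `0` reach negative times; there the trajectory is continued
by zero. -/
theorem state₂_mem_graph_of_le (S : SystemNode X U Y) (α : S.RealResolvent) {T : ℝ}
    {f : ℝ → U} (hf : LocallyIntegrable f) (hf0 : ∀ t < 0, f t = 0) {t : ℝ} (ht : t ≤ T) :
    ((S.state₂ α T f t, prim₂ f t), S.state₁ α T f t) ∈ S.AB.graph := by
  rcases le_total 0 t with h0 | h0
  · exact S.state₂_mem_graph α hf ⟨h0, ht⟩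
  · obtain ⟨h1, h2, h3⟩ := S.state_eq_zero α (T := T) hf0 h0
    rw [h1, h2, h3]
    exact S.AB.graph.zero_mem

/-! ### The twice integrated output -/

/-- The twice integrated output `C&D ∫₀ᵗ (t - τ) (𝔅_τ f, f(τ)) dτ`. -/
def output₂ (S : SystemNode X U Y) (α : S.RealResolvent) (T : ℝ) (f : ℝ → U) (t : ℝ) : Y :=
  S.CDext α (S.embed α (S.state₂ α T f t), prim₂ f t)

theorem continuousOn_output₂ (S : SystemNode X U Y) (α : S.RealResolvent) {T : ℝ} (hT : 0 ≤ T)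
    {f : ℝ → U} (hf : LocallyIntegrable f) : ContinuousOn (S.output₂ α T f) (Icc 0 T) := by
  have hx : Continuous (S.state₂ α T f) :=
    continuous_iff_continuousAt.2 fun t => (S.hasDerivAt_state₂ α hT hf t).continuousAt
  exact S.continuousOn_CDext α hx.continuousOn (S.continuous_state₁ α hT hf).continuousOn
    (continuous_prim₂ hf).continuousOn fun t ht => S.state₂_mem_graph α hf ht

theorem norm_prim_le {E : Type*} [NormedAddCommGroup E] [NormedSpace ℝ E] {f : ℝ → E} {T K : ℝ}
    (hK : 0 ≤ K) (hf : ∀ t ∈ Icc 0 T, ‖f t‖ ≤ K) {t : ℝ} (ht : t ∈ Icc 0 T) :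
    ‖∫ s in (0 : ℝ)..t, f s‖ ≤ T * K := by
  have h := intervalIntegral.norm_integral_le_of_norm_le_const (f := f) (a := 0) (b := t) (C := K)
    fun s hs => by
      rw [uIoc_of_le ht.1] at hs
      exact hf s ⟨hs.1.le, hs.2.trans ht.2⟩
  rw [sub_zero, abs_of_nonneg ht.1, mul_comm] at h
  exact h.trans (by gcongr; exact ht.2)

/-- The graph norm of the twice integrated trajectory involves only `state₂`, `prim₂ f` and
`state₁`, and each is dominated by the `L¹` norm of the input. -/
theorem exists_bound_output₂ (S : SystemNode X U Y) (α : S.RealResolvent) {T : ℝ} (hT : 0 ≤ T) :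
    ∃ C : ℝ, 0 ≤ C ∧ ∀ f : ℝ → U, LocallyIntegrable f → ∀ t ∈ Icc 0 T,
      ‖S.output₂ α T f t‖ ≤ C * ∫ s in (0 : ℝ)..T, ‖f s‖ := by
  obtain ⟨c, hc0, hc⟩ := S.exists_bound_CDext α
  obtain ⟨M, hM0, hM⟩ := S.isC0Semigroup.exists_bound_trunc hT
  set β := ‖S.reprControl α‖ with hβ
  -- One summand for each of the three terms of `state₁`.
  set k := |α.1| * (T * (M * β)) + M * β + β with hk
  have hβ0 : 0 ≤ β := norm_nonneg _
  have hk0 : 0 ≤ k := by positivity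
  refine ⟨c * (T * k + T + k), by positivity, fun f hf t ht => ?_⟩
  set I := ∫ s in (0 : ℝ)..T, ‖f s‖ with hI
  have hI0 : 0 ≤ I := intervalIntegral.integral_nonneg hT fun s _ => norm_nonneg _
  have hi := intervalIntegrable_of_locallyIntegrable hf
  have hr : ∀ t ∈ Icc 0 T, ‖S.stateR α T f t‖ ≤ M * β * I := fun t ht => by
    have hbf := S.locallyIntegrable_reprControl α hf
    refine (semigroupConv_norm_le hM0 hM hbf ht).trans ?_
    rw [mul_assoc]
    gcongr
    rw [hI, ← intervalIntegral.integral_const_mul]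
    exact intervalIntegral.integral_mono_on hT
      (intervalIntegrable_of_locallyIntegrable hbf 0 T).norm ((hi 0 T).norm.const_mul β)
      fun s _ => (S.reprControl α).le_opNorm _
  have hu : ∀ t ∈ Icc 0 T, ‖∫ s in (0 : ℝ)..t, f s‖ ≤ I := fun t ht =>
    (intervalIntegral.norm_integral_le_integral_norm ht.1).trans
      (intervalIntegral.integral_mono_interval le_rfl ht.1 ht.2
        (Eventually.of_forall fun s => norm_nonneg _) (hi _ _).norm)
  have hx1 : ∀ t ∈ Icc 0 T, ‖S.state₁ α T f t‖ ≤ k * I := fun t ht => by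
    have h1 := norm_prim_le (by positivity) hr ht
    have h2 : ‖(α.1 : ℂ) • ∫ τ in (0 : ℝ)..t, S.stateR α T f τ‖ ≤ |α.1| * (T * (M * β * I)) := by
      rw [norm_smul, Complex.norm_real, Real.norm_eq_abs]
      gcongr
    have h3 : ‖S.reprControl α (∫ τ in (0 : ℝ)..t, f τ)‖ ≤ β * I :=
      ((S.reprControl α).le_opNorm _).trans (by gcongr; exact hu t ht)
    calc _ ≤ _ := norm_add_le _ _
      _ ≤ _ := add_le_add (norm_sub_le _ _) le_rfl
      _ ≤ _ := add_le_add (add_le_add h2 (hr t ht)) h3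
      _ = k * I := by rw [hk]; ring
  have hx2 : ‖S.state₂ α T f t‖ ≤ T * (k * I) := norm_prim_le (by positivity) hx1 ht
  have hu2 : ‖prim₂ f t‖ ≤ T * I := norm_prim_le hI0 hu ht
  calc _ ≤ c * (‖S.state₂ α T f t‖ + ‖prim₂ f t‖ + ‖S.state₁ α T f t‖) :=
        hc _ _ _ (S.state₂_mem_graph α hf ht)
    _ ≤ c * (T * (k * I) + T * I + k * I) := by gcongr; exact hx1 t ht
    _ = _ := by ring

end SystemNode
end SysNode

namespace SysNode

/-! ### Extension by zero -/

section zeroExtension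

variable {E : Type*} [NormedAddCommGroup E] {T : ℝ}

/-- The extension of an `L²` function on `[0,T]` by zero. -/
def zeroExt (u : L2 T E) : ℝ → E := (Icc (0 : ℝ) T).indicator u

theorem zeroExt_eq (u : L2 T E) {t : ℝ} (ht : t ∈ Icc 0 T) : zeroExt u t = u t :=
  indicator_of_mem ht _

theorem zeroExt_of_neg (u : L2 T E) : ∀ t < 0, zeroExt u t = 0 := fun _ ht =>
  indicator_of_notMem (fun h => absurd h.1 (not_le.2 ht)) _

theorem locallyIntegrable_zeroExt (u : L2 T E) : LocallyIntegrable (zeroExt u) :=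
  ((integrable_indicator_iff measurableSet_Icc).2
    ((Lp.memLp u).integrable (by norm_num))).locallyIntegrable

theorem zeroExt_comb [NormedSpace ℂ E] (c d : ℂ) (u v : L2 T E) :
    zeroExt (c • u + d • v) =ᵐ[volume] fun s => c • zeroExt u s + d • zeroExt v s := by
  have h : ∀ᵐ s ∂(volume.restrict (Icc (0 : ℝ) T)), (c • u + d • v : L2 T E) s = c • u s + d • v s := by
    filter_upwards [Lp.coeFn_add (c • u) (d • v), Lp.coeFn_smul c u, Lp.coeFn_smul d v]
      with s h1 h2 h3
    rw [h1, Pi.add_apply, h2, h3, Pi.smul_apply, Pi.smul_apply]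
  filter_upwards [(ae_restrict_iff' measurableSet_Icc).1 h] with s hs
  by_cases hsT : s ∈ Icc 0 T
  · simp only [zeroExt_eq _ hsT, hs hsT]
  · simp [zeroExt, hsT]

theorem toL2_congr {f g : ℝ → E} (h : ∀ t ∈ Icc 0 T, f t = g t) : toL2 T f = toL2 T g := by
  have hae : f =ᵐ[volume.restrict (Icc (0 : ℝ) T)] g :=
    (ae_restrict_mem measurableSet_Icc).mono h
  unfold toL2
  by_cases hf : MemLp f 2 (volume.restrict (Icc (0 : ℝ) T))
  · rw [dif_pos hf, dif_pos ((memLp_congr_ae hae).1 hf)]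
    exact MemLp.toLp_congr _ _ hae
  · rw [dif_neg hf, dif_neg fun hg => hf ((memLp_congr_ae hae).2 hg)]

theorem toL2_comb [NormedSpace ℂ E] {f g : ℝ → E} (hf : ContinuousOn f (Icc 0 T))
    (hg : ContinuousOn g (Icc 0 T)) (c d : ℂ) :
    toL2 T (fun t => c • f t + d • g t) = c • toL2 T f + d • toL2 T g := by
  refine Lp.ext ?_
  filter_upwards [toL2_coeFn (memLp_of_continuousOn hf), toL2_coeFn (memLp_of_continuousOn hg),
    toL2_coeFn (memLp_of_continuousOn ((hf.const_smul c).add (hg.const_smul d))),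
    Lp.coeFn_add (c • toL2 T f) (d • toL2 T g), Lp.coeFn_smul c (toL2 T f),
    Lp.coeFn_smul d (toL2 T g)] with t h1 h2 h3 h4 h5 h6
  rw [h4, Pi.add_apply, h5, h6, Pi.smul_apply, Pi.smul_apply, h1, h2]
  exact h3

theorem toL2_smul [NormedSpace ℂ E] {f : ℝ → E} (hf : ContinuousOn f (Icc 0 T)) (c : ℂ) :
    toL2 T (fun t => c • f t) = c • toL2 T f := by
  simpa using toL2_comb hf hf c 0

theorem L2.enorm_sq (u : L2 T E) : ‖u‖ₑ ^ 2 = ∫⁻ t in Icc (0 : ℝ) T, ‖u t‖ₑ ^ 2 := by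
  rw [Lp.enorm_def, eLpNorm_eq_lintegral_rpow_enorm_toReal (by norm_num) (by norm_num),
    ← ENNReal.rpow_two, ← ENNReal.rpow_mul]
  norm_num

theorem enorm_toL2_sq {f : ℝ → E} (hf : ContinuousOn f (Icc 0 T)) :
    ‖toL2 T f‖ₑ ^ 2 = ∫⁻ t in Icc (0 : ℝ) T, ‖f t‖ₑ ^ 2 := by
  rw [L2.enorm_sq]
  refine lintegral_congr_ae ?_
  filter_upwards [toL2_coeFn (memLp_of_continuousOn hf)] with t ht
  rw [ht]

theorem lintegral_zeroExt (u : L2 T E) : ∫⁻ t in Icc (0 : ℝ) T, ‖zeroExt u t‖ₑ ^ 2 = ‖u‖ₑ ^ 2 := by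
  rw [L2.enorm_sq]
  exact setLIntegral_congr_fun measurableSet_Icc fun t ht => by simp only [zeroExt_eq u ht]

theorem lintegral_Iic_zeroExt (u : L2 T E) : ∫⁻ t in Iic T, ‖zeroExt u t‖ₑ ^ 2 = ‖u‖ₑ ^ 2 := by
  have e : ∀ t, ‖zeroExt u t‖ₑ ^ 2 = (Icc (0 : ℝ) T).indicator (fun t => ‖zeroExt u t‖ₑ ^ 2) t := by
    intro t
    by_cases h : t ∈ Icc 0 T
    · rw [indicator_of_mem h]
    · rw [indicator_of_notMem h, zeroExt, indicator_of_notMem h]; simp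
  rw [← lintegral_zeroExt, lintegral_congr e, lintegral_indicator measurableSet_Icc,
    Measure.restrict_restrict measurableSet_Icc, inter_eq_self_of_subset_left Icc_subset_Iic_self]

/-- Comparison of the `L¹` and `L²` norms on a set of finite measure. -/
theorem exists_bound_integral_zeroExt (T : ℝ) (hT : 0 ≤ T) : ∃ C : ℝ, 0 ≤ C ∧ ∀ u : L2 T E,
    ∫ s in (0 : ℝ)..T, ‖zeroExt u s‖ ≤ C * ‖u‖ := by
  set μ := volume.restrict (Icc (0 : ℝ) T) with hμ
  set m : ℝ≥0∞ := μ univ ^ (1 / (1 : ℝ≥0∞).toReal - 1 / (2 : ℝ≥0∞).toReal) with hm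
  have hmt : m ≠ ∞ := by
    refine ENNReal.rpow_ne_top_of_nonneg (by norm_num) ?_
    simp [hμ]
  refine ⟨m.toReal, ENNReal.toReal_nonneg, fun u => ?_⟩
  have h1 := eLpNorm_le_eLpNorm_mul_rpow_measure_univ (μ := μ) (p := 1) (q := 2) (by norm_num)
    (Lp.aestronglyMeasurable u)
  have h2 : ∫ s in (0 : ℝ)..T, ‖zeroExt u s‖ = (eLpNorm u 1 μ).toReal := by
    rw [intervalIntegral.integral_of_le hT, ← integral_Icc_eq_integral_Ioc,
      setIntegral_congr_fun (g := fun s => ‖u s‖) measurableSet_Icc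
        (fun s hs => by simp only [zeroExt_eq u hs]),
      eLpNorm_one_eq_lintegral_enorm, integral_norm_eq_lintegral_enorm (Lp.aestronglyMeasurable u)]
  rw [h2, Lp.norm_def, ← ENNReal.toReal_mul, mul_comm m]
  exact ENNReal.toReal_mono (ENNReal.mul_ne_top (Lp.eLpNorm_ne_top u) hmt) h1

end zeroExtension

namespace SystemNode

variable {X U Y : Type*} [NormedAddCommGroup X] [InnerProductSpace ℂ X]
  [NormedAddCommGroup U] [InnerProductSpace ℂ U] [NormedAddCommGroup Y] [InnerProductSpace ℂ Y]
  [CompleteSpace X] [CompleteSpace U]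

/-! ### The input maps in terms of integrated trajectories -/

theorem inputToState_eq (S : SystemNode X U Y) (α : S.RealResolvent) {T : ℝ} (u : L2 T U) {t : ℝ}
    (ht : t ∈ Icc 0 T) :
    S.inputToState α t u = (S.repr α).symm (S.stateR α T (zeroExt u) t) := by
  change (∫ s in (0 : ℝ)..t, S.semigroup (t - s) (S.reprControl α (u s)) : X) =
    ∫ s in (0 : ℝ)..t, truncSemigroup S.semigroup T (t - s) (S.reprControl α (zeroExt u s))
  refine intervalIntegral.integral_congr fun s hs => ?_
  rw [uIcc_of_le ht.1] at hs
  rw [zeroExt_eq u ⟨hs.1, hs.2.trans ht.2⟩,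
    truncSemigroup_eq ⟨sub_nonneg.2 hs.2, by linarith [hs.1, ht.2]⟩]

theorem prim₂_eq {E : Type*} [NormedAddCommGroup E] [NormedSpace ℝ E] [CompleteSpace E] {f : ℝ → E}
    (hf : LocallyIntegrable f) {t : ℝ} (ht : 0 ≤ t) :
    ∫ τ in (0 : ℝ)..t, (t - τ) • f τ = prim₂ f t :=
  integral_sub_smul ht (intervalIntegrable_of_locallyIntegrable hf 0 t)

/-- Cauchy's formula in both components. Together with `state₂_mem_graph` it shows that `𝔇_T`
evaluates `CDext` only inside `dom(A&B)`, never at its default value `0`. -/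
theorem integral_pair_eq (S : SystemNode X U Y) (α : S.RealResolvent) {T : ℝ} (u : L2 T U) {t : ℝ}
    (ht : t ∈ Icc 0 T) :
    ∫ τ in (0 : ℝ)..t, (t - τ) • ((S.inputToState α τ u, u τ) : S.Extrap α × U) =
      (S.embed α (S.state₂ α T (zeroExt u) t), prim₂ (zeroExt u) t) := by
  have hT := ht.1.trans ht.2
  have hu := locallyIntegrable_zeroExt u
  have hr := (S.continuous_stateR α hT hu).locallyIntegrable (μ := volume)
  have h1 : ∀ τ ∈ uIcc 0 t, (t - τ) • ((S.inputToState α τ u, u τ) : S.Extrap α × U) =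
      ((t - τ) • (S.repr α).symm (S.stateR α T (zeroExt u) τ), (t - τ) • zeroExt u τ) := by
    intro τ hτ
    rw [uIcc_of_le ht.1] at hτ
    have hτT : τ ∈ Icc 0 T := ⟨hτ.1, hτ.2.trans ht.2⟩
    rw [S.inputToState_eq α u hτT, zeroExt_eq u hτT, Prod.smul_mk]
  have hsub : Continuous fun τ : ℝ => t - τ := by fun_prop
  have i1 : IntervalIntegrable (fun τ => (t - τ) • (S.repr α).symm (S.stateR α T (zeroExt u) τ))
      volume 0 t :=
    (hsub.smul ((S.repr α).symm.continuous.comp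
      (S.continuous_stateR α hT hu))).intervalIntegrable 0 t
  have i2 : IntervalIntegrable (fun τ => (t - τ) • zeroExt u τ) volume 0 t :=
    (intervalIntegrable_of_locallyIntegrable hu 0 t).continuousOn_smul hsub.continuousOn
  rw [intervalIntegral.integral_congr h1, intervalIntegral.integral_of_le ht.1,
    integral_pair ((intervalIntegrable_iff_integrableOn_Ioc_of_le ht.1).1 i1)
      ((intervalIntegrable_iff_integrableOn_Ioc_of_le ht.1).1 i2),
    ← intervalIntegral.integral_of_le ht.1, ← intervalIntegral.integral_of_le ht.1,
    prim₂_eq hu ht.1]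
  refine Prod.ext ?_ rfl
  change (∫ τ in (0 : ℝ)..t, (t - τ) • S.stateR α T (zeroExt u) τ : X) =
    S.resolvent α (S.state₂ α T (zeroExt u) t)
  rw [S.resolvent_state₂ α hu ht, prim₂_eq hr ht.1]

theorem inputToOutput_eq (S : SystemNode X U Y) (α : S.RealResolvent) {T : ℝ} (u : L2 T U) :
    S.inputToOutput α u = secondDeriv (toL2 T (S.output₂ α T (zeroExt u))) := by
  unfold inputToOutput
  congr 1
  refine toL2_congr fun t ht => ?_
  rw [S.integral_pair_eq α u ht]
  rfl

/-! ### Linearity -/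

theorem prim_comb {E : Type*} [NormedAddCommGroup E] [NormedSpace ℂ E] {f g : ℝ → E}
    (hf : LocallyIntegrable f) (hg : LocallyIntegrable g) (c d : ℂ) (t : ℝ) :
    ∫ s in (0 : ℝ)..t, (c • f s + d • g s) =
      c • (∫ s in (0 : ℝ)..t, f s) + d • ∫ s in (0 : ℝ)..t, g s := by
  have i1 : IntervalIntegrable (fun s => c • f s) volume 0 t :=
    (intervalIntegrable_of_locallyIntegrable hf 0 t).smul c
  have i2 : IntervalIntegrable (fun s => d • g s) volume 0 t :=
    (intervalIntegrable_of_locallyIntegrable hg 0 t).smul d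
  rw [intervalIntegral.integral_add i1 i2, intervalIntegral.integral_smul,
    intervalIntegral.integral_smul]

theorem prim₂_comb {E : Type*} [NormedAddCommGroup E] [NormedSpace ℂ E] {f g : ℝ → E}
    (hf : LocallyIntegrable f) (hg : LocallyIntegrable g) (c d : ℂ) (t : ℝ) :
    prim₂ (fun s => c • f s + d • g s) t = c • prim₂ f t + d • prim₂ g t := by
  simp only [prim₂, prim_comb hf hg]
  exact prim_comb (continuous_prim hf).locallyIntegrable (continuous_prim hg).locallyIntegrable c d t

theorem stateR_comb (S : SystemNode X U Y) (α : S.RealResolvent) {T : ℝ} (hT : 0 ≤ T)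
    {f g : ℝ → U} (hf : LocallyIntegrable f) (hg : LocallyIntegrable g) (c d : ℂ) (t : ℝ) :
    S.stateR α T (fun s => c • f s + d • g s) t = c • S.stateR α T f t + d • S.stateR α T g t := by
  have key : ∀ {h : ℝ → U}, LocallyIntegrable h → IntervalIntegrable
      (fun s => truncSemigroup S.semigroup T (t - s) (S.reprControl α (h s))) volume 0 t :=
    fun hh => S.isC0Semigroup.intervalIntegrable_conv hT
      (intervalIntegrable_of_locallyIntegrable (S.locallyIntegrable_reprControl α hh) 0 t) t
  have i1 : IntervalIntegrable (fun s => c • truncSemigroup S.semigroup T (t - s)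
    (S.reprControl α (f s))) volume 0 t := (key hf).smul c
  have i2 : IntervalIntegrable (fun s => d • truncSemigroup S.semigroup T (t - s)
    (S.reprControl α (g s))) volume 0 t := (key hg).smul d
  simp only [stateR, semigroupConv, map_add, map_smul]
  rw [intervalIntegral.integral_add i1 i2, intervalIntegral.integral_smul,
    intervalIntegral.integral_smul]

theorem state₂_comb (S : SystemNode X U Y) (α : S.RealResolvent) {T : ℝ} (hT : 0 ≤ T)
    {f g : ℝ → U} (hf : LocallyIntegrable f) (hg : LocallyIntegrable g) (c d : ℂ) (t : ℝ) :
    S.state₂ α T (fun s => c • f s + d • g s) t = c • S.state₂ α T f t + d • S.state₂ α T g t := by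
  have hrf := (S.continuous_stateR α hT hf).locallyIntegrable (μ := volume)
  have hrg := (S.continuous_stateR α hT hg).locallyIntegrable (μ := volume)
  have h1 : ∀ t, S.state₁ α T (fun s => c • f s + d • g s) t =
      c • S.state₁ α T f t + d • S.state₁ α T g t := fun t => by
    simp only [state₁, S.stateR_comb α hT hf hg, prim_comb hf hg, prim_comb hrf hrg, map_add,
      map_smul, smul_add, smul_sub, smul_comm (α.1 : ℂ)]
    abel
  simp only [state₂, h1]
  exact prim_comb (S.continuous_state₁ α hT hf).locallyIntegrable
    (S.continuous_state₁ α hT hg).locallyIntegrable c d t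

theorem output₂_comb (S : SystemNode X U Y) (α : S.RealResolvent) {T : ℝ}
    {f g : ℝ → U} (hf : LocallyIntegrable f) (hg : LocallyIntegrable g) (c d : ℂ) {t : ℝ}
    (ht : t ∈ Icc 0 T) :
    S.output₂ α T (fun s => c • f s + d • g s) t = c • S.output₂ α T f t + d • S.output₂ α T g t := by
  have h1 := S.mem_domain_of_graph (S.state₂_mem_graph α hf ht)
  have h2 := S.mem_domain_of_graph (S.state₂_mem_graph α hg ht)
  simp only [output₂]
  rw [S.state₂_comb α (ht.1.trans ht.2) hf hg, prim₂_comb hf hg,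
    S.CDext_add α (S.AB.domain.smul_mem c h1) (S.AB.domain.smul_mem d h2),
    S.CDext_smul α c h1, S.CDext_smul α d h2]

theorem prim_congr {E : Type*} [NormedAddCommGroup E] [NormedSpace ℝ E] {f g : ℝ → E}
    (h : f =ᵐ[volume] g) (t : ℝ) : ∫ s in (0 : ℝ)..t, f s = ∫ s in (0 : ℝ)..t, g s :=
  intervalIntegral.integral_congr_ae (h.mono fun _ hs _ => hs)

theorem stateR_congr (S : SystemNode X U Y) (α : S.RealResolvent) (T : ℝ) {f g : ℝ → U}
    (h : f =ᵐ[volume] g) (t : ℝ) : S.stateR α T f t = S.stateR α T g t :=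
  prim_congr (h.mono fun s hs => by simp only [hs]) t

theorem output₂_congr (S : SystemNode X U Y) (α : S.RealResolvent) (T : ℝ) {f g : ℝ → U}
    (h : f =ᵐ[volume] g) (t : ℝ) : S.output₂ α T f t = S.output₂ α T g t := by
  simp only [output₂, state₂, state₁, prim₂, S.stateR_congr α T h, prim_congr h]

theorem inputToState_comb (S : SystemNode X U Y) (α : S.RealResolvent) {T : ℝ} (c d : ℂ)
    (u v : L2 T U) {t : ℝ} (ht : t ∈ Icc 0 T) :
    S.inputToState α t (c • u + d • v) = c • S.inputToState α t u + d • S.inputToState α t v := by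
  rw [S.inputToState_eq α _ ht, S.inputToState_eq α _ ht, S.inputToState_eq α _ ht,
    S.stateR_congr α T (zeroExt_comb c d u v),
    S.stateR_comb α (ht.1.trans ht.2) (locallyIntegrable_zeroExt u) (locallyIntegrable_zeroExt v),
    map_add, map_smul, map_smul]

theorem toL2_output₂_comb (S : SystemNode X U Y) (α : S.RealResolvent) {T : ℝ} (hT : 0 ≤ T)
    (c d : ℂ) (u v : L2 T U) :
    toL2 T (S.output₂ α T (zeroExt (c • u + d • v))) =
      c • toL2 T (S.output₂ α T (zeroExt u)) + d • toL2 T (S.output₂ α T (zeroExt v)) := by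
  have hu := locallyIntegrable_zeroExt u
  have hv := locallyIntegrable_zeroExt v
  rw [← toL2_comb (S.continuousOn_output₂ α hT hu) (S.continuousOn_output₂ α hT hv)]
  refine toL2_congr fun t ht => ?_
  rw [S.output₂_congr α T (zeroExt_comb c d u v), S.output₂_comb α hu hv c d ht]

/-- The twice integrated input-to-output map as a bounded operator. -/
def outputCLM (S : SystemNode X U Y) (α : S.RealResolvent) {T : ℝ} (hT : 0 ≤ T) :
    L2 T U →L[ℂ] L2 T Y :=
  LinearMap.mkContinuousOfExistsBound
    { toFun := fun u => toL2 T (S.output₂ α T (zeroExt u))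
      map_add' := fun u v => by
        simpa only [one_smul] using S.toL2_output₂_comb α hT 1 1 u v
      map_smul' := fun c u => by
        simpa only [zero_smul, add_zero, RingHom.id_apply] using S.toL2_output₂_comb α hT c 0 u 0 } (by
    obtain ⟨C, hC0, hC⟩ := S.exists_bound_output₂ α hT
    obtain ⟨D, hD0, hD⟩ := exists_bound_integral_zeroExt (E := U) T hT
    -- `C * D * ‖u‖` bounds the output pointwise on `[0,T]`; the first factor, the square root of
    -- the measure, converts this into an `L²` bound.
    refine ⟨(measureUnivNNReal (volume.restrict (Icc (0 : ℝ) T)) : ℝ) ^ (2 : ℝ≥0∞).toReal⁻¹ * (C * D),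
      fun u => ?_⟩
    have hu := locallyIntegrable_zeroExt u
    rw [mul_assoc]
    refine Lp.norm_le_of_ae_bound (by positivity) ?_
    filter_upwards [toL2_coeFn (memLp_of_continuousOn (S.continuousOn_output₂ α hT hu)),
      ae_restrict_mem measurableSet_Icc] with t h1 ht
    rw [LinearMap.coe_mk, AddHom.coe_mk, h1, mul_assoc]
    exact (hC _ hu t ht).trans (by gcongr; exact hD u))

theorem inputToOutput_eq_outputCLM (S : SystemNode X U Y) (α : S.RealResolvent) {T : ℝ}
    (hT : 0 ≤ T) (u : L2 T U) : S.inputToOutput α u = secondDeriv (S.outputCLM α hT u) :=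
  S.inputToOutput_eq α u

theorem inputToOutput_comb (S : SystemNode X U Y) (α : S.RealResolvent) {T : ℝ} (hT : 0 ≤ T)
    (c d : ℂ) (u v : L2 T U) :
    S.inputToOutput α (c • u + d • v) = c • S.inputToOutput α u + d • S.inputToOutput α v := by
  ext w
  simp only [S.inputToOutput_eq_outputCLM α hT, map_add, map_smul, secondDeriv_apply,
    inner_add_right, inner_smul_right, add_apply, smul_apply,
    smul_eq_mul]

theorem ofL2_comb {E : Type*} [NormedAddCommGroup E] [InnerProductSpace ℂ E] {T : ℝ}
    (c d : ℂ) (y z : L2 T E) : ofL2 (c • y + d • z) = c • ofL2 y + d • ofL2 z := by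
  ext w
  simp only [ofL2_apply, inner_add_right, inner_smul_right, add_apply,
    smul_apply, smul_eq_mul]

/-- Equality in `Hneg20l` is tested on each `w` separately. For fixed `w` both sides are continuous
in `(u, y)`, as `u` enters only through the bounded operator `outputCLM`. -/
theorem isClosed_isOutput (S : SystemNode X U Y) (α : S.RealResolvent) {T : ℝ} (hT : 0 ≤ T)
    (x₀ : S.Extrap α) : _root_.IsClosed {q : L2 T U × L2 T Y | S.IsOutput α x₀ q.1 q.2} := by
  have : {q : L2 T U × L2 T Y | S.IsOutput α x₀ q.1 q.2} = ⋂ w : H20r Y T,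
      {q | S.stateToOutput α T x₀ w + inner ℂ (w : L2 T Y × (L2 T Y × L2 T Y)).2.2 (S.outputCLM α hT q.1)
        = inner ℂ (w : L2 T Y × (L2 T Y × L2 T Y)).1 q.2} := by
    ext q
    simp only [mem_ofPred_eq, mem_iInter, IsOutput, ContinuousLinearMap.ext_iff,
      S.inputToOutput_eq_outputCLM α hT, add_apply, secondDeriv_apply, ofL2_apply]
  rw [this]
  exact isClosed_iInter fun w => isClosed_eq (by fun_prop) (by fun_prop)

end SystemNode
end SysNode

namespace SysNode

theorem eLpNorm_sub_toL2 {E : Type*} [NormedAddCommGroup E] {T : ℝ} {f : ℝ → E}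
    (hf : ContinuousOn f (Icc 0 T)) :
    eLpNorm (fun t => f t - toL2 T f t) 2 (volume.restrict (Icc (0 : ℝ) T)) = 0 := by
  rw [← eLpNorm_zero (μ := volume.restrict (Icc (0 : ℝ) T)) (p := 2) (ε := E)]
  refine eLpNorm_congr_ae ?_
  filter_upwards [toL2_coeFn (memLp_of_continuousOn hf)] with t ht
  simp [ht]

theorem mul_norm_sq_le_iff_enorm {E E' : Type*} [NormedAddCommGroup E] [NormedAddCommGroup E']
    {c : ℝ} (hc : 0 ≤ c) (a : E) (b : E') :
    c * ‖a‖ ^ 2 ≤ ‖b‖ ^ 2 ↔ ENNReal.ofReal c * ‖a‖ₑ ^ 2 ≤ ‖b‖ₑ ^ 2 := by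
  rw [← ofReal_norm, ← ofReal_norm, ← ENNReal.ofReal_pow (norm_nonneg _),
    ← ENNReal.ofReal_pow (norm_nonneg _), ← ENNReal.ofReal_mul hc,
    ENNReal.ofReal_le_ofReal_iff (by positivity)]

namespace SystemNode

variable {X U Y Z : Type*} [NormedAddCommGroup X] [InnerProductSpace ℂ X]
  [NormedAddCommGroup U] [InnerProductSpace ℂ U] [NormedAddCommGroup Y] [InnerProductSpace ℂ Y]
  [NormedAddCommGroup Z] [InnerProductSpace ℂ Z]

/-! ### Coercivity along trajectories -/

theorem IsClassicalTrajectory.smul {S : SystemNode X U Y} {T : ℝ} {x : ℝ → X} {u : ℝ → U}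
    {y : ℝ → Y} (h : S.IsClassicalTrajectory T x u y) (c : ℂ) :
    S.IsClassicalTrajectory T (fun t => c • x t) (fun t => c • u t) (fun t => c • y t) := by
  obtain ⟨hu, hy, x', hx', hd⟩ := h
  refine ⟨hu.const_smul c, hy.const_smul c, fun t => c • x' t, hx'.const_smul c, fun t ht => ?_⟩
  obtain ⟨h1, h2, h3, h4⟩ := hd t ht
  refine ⟨h1.const_smul c, S.AB.domain.smul_mem c h2, ?_, ?_⟩
  · simp only
    rw [h3, ← LinearPMap.map_smul]
    rfl
  · simp only
    rw [h4, ← map_smul]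
    rfl

theorem IsClassicalTrajectory.isGeneralizedTrajectory {S : SystemNode X U Y} {T : ℝ} {x : ℝ → X}
    {u : ℝ → U} {y : ℝ → Y} (h : S.IsClassicalTrajectory T x u y) :
    S.IsGeneralizedTrajectory x (toL2 T u) (toL2 T y) := by
  refine ⟨fun _ => x, fun _ => u, fun _ => y, fun _ => h, ?_, ?_, ?_⟩
  · intro s hs
    exact Eventually.of_forall fun _ t _ => refl_mem_uniformity hs
  · simp only [eLpNorm_sub_toL2 h.1]; exact tendsto_const_nhds
  · simp only [eLpNorm_sub_toL2 h.2.1]; exact tendsto_const_nhds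

/-- As the terminal value enters the coercivity estimate along trajectories with power one, the
estimate bounds the input by the output alone. -/
theorem CoerciveOnTrajectories.classical {S : SystemNode X U Y} {T : ℝ} {F : X →L[ℂ] Z}
    (h : S.CoerciveOnTrajectories T F) :
    ∃ c : ℝ, 0 < c ∧ ∀ (x : ℝ → X) (u : ℝ → U) (y : ℝ → Y), S.IsClassicalTrajectory T x u y →
      x 0 = 0 → c * ‖toL2 T u‖ ^ 2 ≤ ‖toL2 T y‖ ^ 2 := by
  obtain ⟨c, hc, H⟩ := h
  refine ⟨c, hc, fun x u y htr hx0 => ?_⟩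
  by_contra! hlt
  set e := c * ‖toL2 T u‖ ^ 2 - ‖toL2 T y‖ ^ 2 with he
  have he0 : 0 < e := sub_pos.2 hlt
  set d := ‖F (x T)‖ with hd
  -- Scaling the trajectory by `l` turns the coercivity estimate into `l * e ≤ d`; this `l` gives `l
  -- * e = d + 1`, a contradiction.
  set l : ℝ := (d + 1) / e with hl
  have hl0 : 0 < l := by positivity
  have h1 := H _ _ _ (htr.smul (l : ℂ)).isGeneralizedTrajectory (by simp [hx0])
  rw [toL2_smul htr.1, toL2_smul htr.2.1, map_smul, norm_smul, norm_smul, norm_smul,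
    Complex.norm_real, Real.norm_eq_abs, abs_of_pos hl0] at h1
  have h2 : l * e = d + 1 := div_mul_cancel₀ _ he0.ne'
  have h3 : l * (l * e) ≤ l * d := by
    rw [he]; linarith
  rw [h2] at h3
  linarith [le_of_mul_le_mul_left h3 hl0]

/-! ### Twofold averages of inputs with square integrable output -/

variable [CompleteSpace X] [CompleteSpace U] [CompleteSpace Y]

/-- If `𝔇_T u` is the class of `y ∈ L²`, then the twice integrated output is the twofold primitive
of `y`. -/
theorem output₂_eq_prim₂ (S : SystemNode X U Y) (α : S.RealResolvent) {T : ℝ} (hT : 0 < T)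
    {u : L2 T U} {y : L2 T Y} (h : S.inputToOutput α u = ofL2 y) {t : ℝ} (ht : t ≤ T) :
    S.output₂ α T (zeroExt u) t = prim₂ (zeroExt y) t := by
  have hu := locallyIntegrable_zeroExt u
  rcases le_total 0 t with h0 | h0
  · rw [S.inputToOutput_eq α u] at h
    have hc := S.continuousOn_output₂ α hT.le hu
    have hae : S.output₂ α T (zeroExt u) =ᵐ[volume.restrict (Icc 0 T)] prim₂ (zeroExt y) := by
      filter_upwards [eq_primitive_of_secondDeriv_eq_ofL2 hT.le h,
        toL2_coeFn (memLp_of_continuousOn hc), ae_restrict_mem measurableSet_Icc] with t h1 h2 ht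
      rw [← h2, h1]
      refine intervalIntegral.integral_congr fun s hs => intervalIntegral.integral_congr fun r hr => ?_
      rw [uIcc_of_le ht.1] at hs
      rw [uIcc_of_le hs.1] at hr
      exact (zeroExt_eq y ⟨hr.1, hr.2.trans (hs.2.trans ht.2)⟩).symm
    -- Both sides are continuous, so equality almost everywhere on the nondegenerate interval
    -- `[0,T]` is equality everywhere.
    exact Measure.eqOn_Icc_of_ae_eq volume hT.ne hae hc
      (continuous_prim₂ (locallyIntegrable_zeroExt y)).continuousOn ⟨h0, ht⟩
  · obtain ⟨-, h2, h3⟩ := S.state_eq_zero α (T := T) (zeroExt_of_neg u) h0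
    have hd := S.mem_domain_of_graph S.AB.graph.zero_mem
    -- Homogeneity with factor `0` gives the value of `CDext` at the origin.
    have h4 := S.CDext_smul α 0 (x := 0) (u := 0) hd
    rw [zero_smul, zero_smul, zero_smul] at h4
    rw [output₂, h2, h3, h4, prim₂_eq_zero (zeroExt_of_neg y) h0]

/-- The mixed second backward difference of step sizes `h` and `k`. -/
def backDiff {E : Type*} [AddCommGroup E] (h k : ℝ) (f : ℝ → E) (t : ℝ) : E :=
  f t - f (t - k) - (f (t - h) - f (t - h - k))

theorem backAvg_backAvg_eq {E : Type*} [NormedAddCommGroup E] [NormedSpace ℂ E] {f : ℝ → E}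
    (hf : LocallyIntegrable f) (h k t : ℝ) :
    backAvg h (backAvg k f) t = ((h⁻¹ * k⁻¹ : ℝ) : ℂ) • backDiff h k (prim₂ f) t := by
  rw [backAvg_backAvg hf, Complex.coe_smul]
  rfl

/-- The twofold backward average of an input with square integrable output belongs to a classical
trajectory, whose output is the twofold backward average of the output. -/
theorem exists_classical_backAvg (S : SystemNode X U Y) (α : S.RealResolvent) {T : ℝ} (hT : 0 < T)
    {u : L2 T U} {y : L2 T Y} (huy : S.inputToOutput α u = ofL2 y) {h k : ℝ} (hh : 0 < h)
    (hk : 0 < k) :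
    ∃ (x : ℝ → X) (z : ℝ → Y),
      S.IsClassicalTrajectory T x (backAvg h (backAvg k (zeroExt u))) z ∧ x 0 = 0 ∧
      ∀ t ∈ Icc 0 T, z t = backAvg h (backAvg k (zeroExt y)) t := by
  set f := zeroExt u with hfdef
  have hf : LocallyIntegrable f := locallyIntegrable_zeroExt u
  have hf0 : ∀ t < 0, f t = 0 := zeroExt_of_neg u
  set a : ℂ := ((h⁻¹ * k⁻¹ : ℝ) : ℂ) with ha
  have hx₁ := S.continuous_state₁ α hT.le hf
  have hd := S.hasDerivAt_state₂ α hT.le hf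
  have hg : ∀ t ≤ T, ((S.state₂ α T f t, prim₂ f t), S.state₁ α T f t) ∈ S.AB.graph :=
    fun t ht => S.state₂_mem_graph_of_le α hf hf0 ht
  have hu : backAvg h (backAvg k f) = fun t => a • backDiff h k (prim₂ f) t :=
    funext fun t => backAvg_backAvg_eq hf h k t
  -- The four times in the second difference are all at most `T`, so this is a linear combination of
  -- graph elements.
  have hgd : ∀ t ∈ Icc 0 T, ((a • backDiff h k (S.state₂ α T f) t, backAvg h (backAvg k f) t),
      a • backDiff h k (S.state₁ α T f) t) ∈ S.AB.graph := by
    intro t ht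
    have := S.AB.graph.smul_mem a (S.AB.graph.sub_mem
      (S.AB.graph.sub_mem (hg t ht.2) (hg (t - k) (by linarith [ht.2])))
      (S.AB.graph.sub_mem (hg (t - h) (by linarith [ht.2])) (hg (t - h - k) (by linarith [ht.2]))))
    rw [hu]
    exact this
  have hcu : Continuous (backAvg h (backAvg k f)) :=
    continuous_backAvg (continuous_backAvg hf k).locallyIntegrable h
  refine ⟨fun t => a • backDiff h k (S.state₂ α T f) t, _,
    S.isClassicalTrajectory_of_graph α (x' := fun t => a • backDiff h k (S.state₁ α T f) t)
      (fun t => ?_) ?_ hcu hgd, ?_, fun t ht => ?_⟩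
  · have h1 := (hd (t - h - k)).comp_sub_const (t - h) k
    have h2 := HasDerivAt.comp_sub_const (f := fun s => S.state₂ α T f (s - k)) t h h1
    exact (((hd t).sub ((hd (t - k)).comp_sub_const t k)).sub
      (((hd (t - h)).comp_sub_const t h).sub h2)).const_smul a
  · refine Continuous.const_smul ?_ a
    unfold backDiff
    fun_prop
  · have z : ∀ t ≤ 0, S.state₂ α T f t = 0 := fun t ht => (S.state_eq_zero α (T := T) hf0 ht).2.1
    simp only [backDiff]
    rw [z _ le_rfl, z _ (by linarith), z _ (by linarith), z _ (by linarith)]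
    simp
  · have dm : ∀ t ≤ T, (S.state₂ α T f t, prim₂ f t) ∈ S.AB.domain := fun t ht =>
      S.mem_domain_of_graph (hg t ht)
    have ds : ∀ {x x' : X} {v v' : U}, (x, v) ∈ S.AB.domain → (x', v') ∈ S.AB.domain →
        (x - x', v - v') ∈ S.AB.domain := fun p p' => S.AB.domain.sub_mem p p'
    have d0 := dm t ht.2
    have d1 := dm (t - k) (by linarith [ht.2])
    have d2 := dm (t - h) (by linarith [ht.2])
    have d3 := dm (t - h - k) (by linarith [ht.2])
    have o : ∀ t ≤ T, S.CDext α (S.embed α (S.state₂ α T f t), prim₂ f t) = prim₂ (zeroExt y) t :=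
      fun t ht => S.output₂_eq_prim₂ α hT huy ht
    simp only [hu]
    rw [backAvg_backAvg_eq (locallyIntegrable_zeroExt y)]
    simp only [backDiff]
    rw [S.CDext_smul α a (ds (ds d0 d1) (ds d2 d3)), S.CDext_sub α (ds d0 d1) (ds d2 d3),
      S.CDext_sub α d0 d1, S.CDext_sub α d2 d3, o t ht.2, o (t - k) (by linarith [ht.2]),
      o (t - h) (by linarith [ht.2]), o (t - h - k) (by linarith [ht.2])]

/-- Coercivity along trajectories extends to all inputs with square integrable output. -/
theorem CoerciveOnTrajectories.le_output {S : SystemNode X U Y} (α : S.RealResolvent) {T : ℝ}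
    (hT : 0 < T) {F : X →L[ℂ] Z} (h : S.CoerciveOnTrajectories T F) :
    ∃ c : ℝ, 0 < c ∧ ∀ (u : L2 T U) (y : L2 T Y), S.inputToOutput α u = ofL2 y →
      c * ‖u‖ ^ 2 ≤ ‖y‖ ^ 2 := by
  obtain ⟨c, hc, H⟩ := h.classical
  refine ⟨c, hc, fun u y huy => ?_⟩
  rw [mul_norm_sq_le_iff_enorm hc.le, ← lintegral_zeroExt u]
  have hu := locallyIntegrable_zeroExt u
  have hy := locallyIntegrable_zeroExt y
  -- The two windows are removed one after the other: for fixed `k` the limit in `h` comes first,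
  -- then the limit in `k`.
  refine lintegral_le_of_backAvg hu (fun k hk => ?_) ENNReal.ofReal_ne_top
  have huk := (continuous_backAvg hu k).locallyIntegrable (μ := volume)
  have hyk := (continuous_backAvg hy k).locallyIntegrable (μ := volume)
  refine lintegral_le_of_backAvg huk (fun h hh => ?_) ENNReal.ofReal_ne_top
  obtain ⟨x, z, htr, hx0, hz⟩ := S.exists_classical_backAvg α hT huy hh hk
  rw [← enorm_toL2_sq htr.1]
  calc _ ≤ ‖toL2 T z‖ₑ ^ 2 := (mul_norm_sq_le_iff_enorm hc.le _ _).1 (H _ _ _ htr hx0)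
    _ = ∫⁻ t in Icc 0 T, ‖backAvg h (backAvg k (zeroExt y)) t‖ₑ ^ 2 := by
        rw [enorm_toL2_sq htr.2.1]
        exact setLIntegral_congr_fun measurableSet_Icc fun t ht => by simp only [hz t ht]
    _ ≤ ∫⁻ t in Iic T, ‖backAvg h (backAvg k (zeroExt y)) t‖ₑ ^ 2 :=
        lintegral_mono_set Icc_subset_Iic_self
    _ ≤ ∫⁻ t in Iic T, ‖backAvg k (zeroExt y) t‖ₑ ^ 2 :=
        lintegral_backAvg_le hyk.aestronglyMeasurable hh T
    _ ≤ ∫⁻ t in Iic T, ‖zeroExt y t‖ₑ ^ 2 := lintegral_backAvg_le hy.aestronglyMeasurable hk T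
    _ = ‖y‖ₑ ^ 2 := lintegral_Iic_zeroExt y

end SystemNode
end SysNode

namespace SysNode

/-! ### Minimisation in Hilbert spaces -/

/-- A decreasing sequence of nonempty closed midpoint-convex subsets of a Hilbert space, the first of
which is bounded, has a common point. -/
theorem nonempty_iInter_of_antitone {H : Type*} [NormedAddCommGroup H] [InnerProductSpace ℂ H]
    [CompleteSpace H] {K : ℕ → Set H} (hanti : Antitone K) (hcl : ∀ n, IsClosed (K n))
    (hne : ∀ n, (K n).Nonempty)
    (hmid : ∀ n, ∀ a ∈ K n, ∀ b ∈ K n, (1 / 2 : ℂ) • a + (1 / 2 : ℂ) • b ∈ K n)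
    {R : ℝ} (hR : ∀ a ∈ K 0, ‖a‖ ≤ R) : (⋂ n, K n).Nonempty := by
  -- The squared least norms of the sets increase and stay below `R ^ 2`, so they converge. Almost
  -- minimal points of `K n` then form a Cauchy sequence, and its limit lies in every `K n`.
  set m : ℕ → ℝ := fun n => sInf ((fun a => ‖a‖ ^ 2) '' K n) with hm
  have hbdd : ∀ n, BddBelow ((fun a => ‖a‖ ^ 2) '' K n) := fun n =>
    ⟨0, by rintro _ ⟨a, -, rfl⟩; positivity⟩
  have hle : ∀ n, ∀ a ∈ K n, m n ≤ ‖a‖ ^ 2 := fun n a ha => csInf_le (hbdd n) ⟨a, ha, rfl⟩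
  have hmono : Monotone m := fun n k hnk =>
    csInf_le_csInf (hbdd n) ((hne k).image _) (image_mono (hanti hnk))
  have hmR : ∀ n, m n ≤ R ^ 2 := fun n => by
    obtain ⟨a, ha⟩ := hne n
    exact (hle n a ha).trans
      (pow_le_pow_left₀ (norm_nonneg _) (hR a (hanti (Nat.zero_le n) ha)) 2)
  have hbm : BddAbove (range m) := ⟨R ^ 2, by rintro _ ⟨n, rfl⟩; exact hmR n⟩
  set L := ⨆ n, m n with hL
  have hmL : Tendsto m atTop (𝓝 L) := tendsto_atTop_ciSup hmono hbm
  have hmL' : ∀ n, m n ≤ L := fun n => le_ciSup hbm n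
  have hex : ∀ n : ℕ, ∃ a ∈ K n, ‖a‖ ^ 2 < m n + 1 / ((n : ℝ) + 1) := fun n => by
    obtain ⟨_, ⟨a, ha, rfl⟩, h⟩ := exists_lt_of_csInf_lt ((hne n).image fun a => ‖a‖ ^ 2)
      (lt_add_of_pos_right (m n) (by positivity : 0 < 1 / ((n : ℝ) + 1)))
    exact ⟨a, ha, h⟩
  choose p hpK hp using hex
  have hcau : CauchySeq p := by
    -- The midpoint of two points of `K N` has squared norm at least `m N`; the parallelogram law
    -- then bounds their squared distance by this radicand.
    refine cauchySeq_of_le_tendsto_0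
      (fun N : ℕ => √(4 * (L - m N) + 4 * (1 / ((N : ℝ) + 1)))) (fun n k N hn hk => ?_) ?_
    · rw [dist_eq_norm]
      refine Real.le_sqrt_of_sq_le ?_
      have hpn := hanti hn (hpK n)
      have hpk := hanti hk (hpK k)
      have h1 := hle N _ (hmid N _ hpn _ hpk)
      rw [← smul_add, norm_smul, mul_pow] at h1
      norm_num at h1
      have h2 := parallelogram_law_with_norm ℂ (p n) (p k)
      have e1 : 1 / ((n : ℝ) + 1) ≤ 1 / ((N : ℝ) + 1) := one_div_le_one_div_of_le (by positivity)
        (by gcongr)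
      have e2 : 1 / ((k : ℝ) + 1) ≤ 1 / ((N : ℝ) + 1) := one_div_le_one_div_of_le (by positivity)
        (by gcongr)
      nlinarith [hp n, hp k, hmL' n, hmL' k]
    · have : Tendsto (fun N : ℕ => 4 * (L - m N) + 4 * (1 / ((N : ℝ) + 1))) atTop (𝓝 0) := by
        simpa using (((tendsto_const_nhds (x := L)).sub hmL).const_mul 4).add
          (tendsto_one_div_add_atTop_nhds_zero_nat.const_mul 4)
      simpa [Function.comp_def] using (Real.continuous_sqrt.tendsto 0).comp this
  obtain ⟨a, ha⟩ := cauchySeq_tendsto_of_complete hcau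
  refine ⟨a, mem_iInter.2 fun n => (hcl n).mem_of_tendsto ha ?_⟩
  filter_upwards [eventually_ge_atTop n] with k hk using hanti hk (hpK k)

/-- Minimisation of the distance of the second component over a closed midpoint-convex set. -/
theorem exists_forall_norm_sub_le {A W : Type*} [NormedAddCommGroup A] [InnerProductSpace ℂ A]
    [CompleteSpace A] [NormedAddCommGroup W] [InnerProductSpace ℂ W] [CompleteSpace W]
    {G : Set (A × W)} (hcl : IsClosed G) (hne : G.Nonempty)
    (hmid : ∀ p ∈ G, ∀ q ∈ G, (1 / 2 : ℂ) • p + (1 / 2 : ℂ) • q ∈ G) (w₀ : W)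
    (hbdd : ∀ R : ℝ, ∃ R' : ℝ, ∀ p ∈ G, ‖p.2 - w₀‖ ≤ R → ‖p.1‖ ≤ R') :
    ∃ p ∈ G, ∀ q ∈ G, ‖p.2 - w₀‖ ≤ ‖q.2 - w₀‖ := by
  set D : Set ℝ := (fun p : A × W => ‖p.2 - w₀‖) '' G with hD
  have hDb : BddBelow D := ⟨0, by rintro _ ⟨a, -, rfl⟩; positivity⟩
  set d := sInf D with hd
  -- Sublevel sets of the distance shrinking to its infimum, placed in the `ℓ²` product because the
  -- supremum norm on `A × W` is not a Hilbert norm.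
  set K : ℕ → Set (WithLp 2 (A × W)) := fun n =>
    {x | WithLp.ofLp x ∈ G ∧ ‖(WithLp.ofLp x).2 - w₀‖ ≤ d + 1 / ((n : ℝ) + 1)} with hK
  -- `d + 1` is the level of the largest set `K 0`.
  obtain ⟨R, hR⟩ := hbdd (d + 1)
  have hcont : Continuous fun x : WithLp 2 (A × W) => WithLp.ofLp x :=
    WithLp.prod_continuous_ofLp 2 A W
  have hKne : (⋂ n, K n).Nonempty := by
    refine nonempty_iInter_of_antitone (R := R + (d + 1 + ‖w₀‖)) ?_ ?_ ?_ ?_ ?_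
    · intro n k hnk x hx
      refine ⟨hx.1, hx.2.trans ?_⟩
      gcongr
    · intro n
      exact (hcl.preimage hcont).inter
        (isClosed_le ((hcont.snd.sub continuous_const).norm) continuous_const)
    · intro n
      obtain ⟨_, ⟨p, hp, rfl⟩, h⟩ := exists_lt_of_csInf_lt (s := D) (hne.image _)
        (lt_add_of_pos_right d (by positivity : 0 < 1 / ((n : ℝ) + 1)))
      exact ⟨WithLp.toLp 2 p, hp, h.le⟩
    · intro n a ha b hb
      refine ⟨hmid _ ha.1 _ hb.1, ?_⟩
      have e : (WithLp.ofLp ((1 / 2 : ℂ) • a + (1 / 2 : ℂ) • b)).2 - w₀ =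
          (1 / 2 : ℂ) • ((WithLp.ofLp a).2 - w₀) + (1 / 2 : ℂ) • ((WithLp.ofLp b).2 - w₀) := by
        have : w₀ = (1 / 2 : ℂ) • w₀ + (1 / 2 : ℂ) • w₀ := by
          rw [← add_smul]; norm_num
        simp only [WithLp.ofLp_add, WithLp.ofLp_smul, Prod.snd_add, Prod.smul_snd, smul_sub]
        nth_rewrite 1 [this]
        abel
      rw [e]
      refine (norm_add_le _ _).trans ?_
      have hh : ‖(1 / 2 : ℂ)‖ = 1 / 2 := by norm_num
      rw [norm_smul, norm_smul, hh]
      linarith [ha.2, hb.2]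
    · intro a ha
      have h1 : ‖(WithLp.ofLp a).2 - w₀‖ ≤ d + 1 := by simpa using ha.2
      have h2 := hR _ ha.1 h1
      have h3 : ‖(WithLp.ofLp a).2‖ ≤ d + 1 + ‖w₀‖ := by
        have := norm_add_le ((WithLp.ofLp a).2 - w₀) w₀
        rw [sub_add_cancel] at this
        linarith
      have h4 := WithLp.prod_norm_sq_eq_of_L2 a
      have h5 := norm_nonneg (WithLp.ofLp a).1
      have h6 := norm_nonneg (WithLp.ofLp a).2
      have h7 : ‖a‖ ^ 2 ≤ (‖(WithLp.ofLp a).1‖ + ‖(WithLp.ofLp a).2‖) ^ 2 := by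
        rw [h4]
        change ‖(WithLp.ofLp a).1‖ ^ 2 + ‖(WithLp.ofLp a).2‖ ^ 2 ≤ _
        nlinarith
      exact (le_of_sq_le_sq h7 (by positivity)).trans (add_le_add h2 h3)
  obtain ⟨x, hx⟩ := hKne
  rw [mem_iInter] at hx
  refine ⟨WithLp.ofLp x, (hx 0).1, fun q hq => ?_⟩
  have h1 : ‖(WithLp.ofLp x).2 - w₀‖ ≤ d := by
    have := tendsto_one_div_add_atTop_nhds_zero_nat (𝕜 := ℝ).const_add d
    rw [add_zero] at this
    exact ge_of_tendsto' this fun n => (hx n).2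
  exact h1.trans (csInf_le hDb ⟨q, hq, rfl⟩)

namespace SystemNode

variable {X U Y Z : Type*} [NormedAddCommGroup X] [InnerProductSpace ℂ X]
  [NormedAddCommGroup U] [InnerProductSpace ℂ U] [NormedAddCommGroup Y] [InnerProductSpace ℂ Y]
  [NormedAddCommGroup Z] [InnerProductSpace ℂ Z] [CompleteSpace X] [CompleteSpace U]

/-! ### The graphs of the terminal value map and of the output map -/

/-- For fixed `x₀` the relation is the sequential closure, in the pair `(u, z)`, of the terminal
values given by states in `X`. -/
theorem isClosed_isTerminalValue (S : SystemNode X U Y) (α : S.RealResolvent) {T : ℝ}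
    (F : X →L[ℂ] Z) (x₀ : S.Extrap α) :
    _root_.IsClosed {q : L2 T U × Z | S.IsTerminalValue α F x₀ q.1 q.2} := by
  have : {q : L2 T U × Z | S.IsTerminalValue α F x₀ q.1 q.2} =
      closure {q | ∃ x, S.semigroupExt α T x₀ + S.inputToState α T q.1 = S.embed α x ∧ F x = q.2} := by
    ext ⟨u, z⟩
    rw [mem_closure_iff_seq_limit, mem_ofPred_eq]
    constructor
    · rintro ⟨un, xn, h1, h2, h3⟩
      exact ⟨fun n => (un n, F (xn n)), fun n => ⟨xn n, h2 n, rfl⟩, h1.prodMk_nhds h3⟩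
    · rintro ⟨qn, h1, h2⟩
      choose xn h3 h4 using h1
      refine ⟨fun n => (qn n).1, xn, (continuous_fst.tendsto _).comp h2, h3, ?_⟩
      simp only [h4]
      exact (continuous_snd.tendsto _).comp h2
  rw [this]
  exact isClosed_closure

theorem IsTerminalValue.comb {S : SystemNode X U Y} {α : S.RealResolvent} {T : ℝ} (hT : 0 ≤ T)
    {F : X →L[ℂ] Z} {x₀ x₀' : S.Extrap α} {u u' : L2 T U} {z z' : Z} (c d : ℂ)
    (h : S.IsTerminalValue α F x₀ u z) (h' : S.IsTerminalValue α F x₀' u' z') :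
    S.IsTerminalValue α F (c • x₀ + d • x₀') (c • u + d • u') (c • z + d • z') := by
  obtain ⟨un, xn, h1, h2, h3⟩ := h
  obtain ⟨un', xn', h1', h2', h3'⟩ := h'
  refine ⟨fun n => c • un n + d • un' n, fun n => c • xn n + d • xn' n,
    (h1.const_smul c).add (h1'.const_smul d), fun n => ?_, ?_⟩
  · rw [S.inputToState_comb α c d _ _ (right_mem_Icc.2 hT)]
    simp only [map_add, map_smul]
    rw [← h2 n, ← h2' n]
    simp only [smul_add]
    abel
  · simp only [map_add, map_smul]
    exact (h3.const_smul c).add (h3'.const_smul d)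

theorem half_smul_add_half_smul {E : Type*} [AddCommGroup E] [Module ℂ E] (x : E) :
    (1 / 2 : ℂ) • x + (1 / 2 : ℂ) • x = x := by
  rw [← add_smul]; norm_num

theorem IsTerminalValue.midpoint {S : SystemNode X U Y} {α : S.RealResolvent} {T : ℝ} (hT : 0 ≤ T)
    {F : X →L[ℂ] Z} {x₀ : S.Extrap α} {u u' : L2 T U} {z z' : Z}
    (h : S.IsTerminalValue α F x₀ u z) (h' : S.IsTerminalValue α F x₀ u' z') :
    S.IsTerminalValue α F x₀ ((1 / 2 : ℂ) • u + (1 / 2 : ℂ) • u')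
      ((1 / 2 : ℂ) • z + (1 / 2 : ℂ) • z') := by
  have := h.comb hT (1 / 2) (1 / 2) h'
  rwa [half_smul_add_half_smul] at this

/-- The initial state cancels in differences. This, with `IsOutput.sub`, is what makes the
coercivity estimates for zero initial state usable when `x₀ ≠ 0`. -/
theorem IsTerminalValue.sub {S : SystemNode X U Y} {α : S.RealResolvent} {T : ℝ} (hT : 0 ≤ T)
    {F : X →L[ℂ] Z} {x₀ : S.Extrap α} {u u' : L2 T U} {z z' : Z}
    (h : S.IsTerminalValue α F x₀ u z) (h' : S.IsTerminalValue α F x₀ u' z') :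
    S.IsTerminalValue α F 0 (u - u') (z - z') := by
  have := h.comb hT 1 (-1) h'
  simpa only [one_smul, neg_smul, ← sub_eq_add_neg, sub_self] using this

theorem IsOutput.midpoint {S : SystemNode X U Y} {α : S.RealResolvent} {T : ℝ} (hT : 0 ≤ T)
    {x₀ : S.Extrap α} {u u' : L2 T U} {y y' : L2 T Y}
    (h : S.IsOutput α x₀ u y) (h' : S.IsOutput α x₀ u' y') :
    S.IsOutput α x₀ ((1 / 2 : ℂ) • u + (1 / 2 : ℂ) • u') ((1 / 2 : ℂ) • y + (1 / 2 : ℂ) • y') := by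
  unfold IsOutput at *
  rw [ofL2_comb, S.inputToOutput_comb α hT, ← h, ← h']
  ext w
  simp only [add_apply, smul_apply, smul_eq_mul]
  ring

theorem IsOutput.sub {S : SystemNode X U Y} {α : S.RealResolvent} {T : ℝ} (hT : 0 ≤ T)
    {x₀ : S.Extrap α} {u u' : L2 T U} {y y' : L2 T Y}
    (h : S.IsOutput α x₀ u y) (h' : S.IsOutput α x₀ u' y') :
    S.inputToOutput α (u - u') = ofL2 (y - y') := by
  unfold IsOutput at *
  have h1 := S.inputToOutput_comb α hT 1 (-1) u u'
  have h2 := ofL2_comb 1 (-1) y y'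
  rw [one_smul, one_smul, neg_one_smul, ← sub_eq_add_neg] at h1 h2
  rw [h1, h2, ← h, ← h']
  ext w
  simp only [add_apply, smul_apply, smul_eq_mul]
  ring

/-- The output alone already controls the input, so the terminal term may be added for free. -/
theorem CoerciveOnTrajectories.coerciveOnDomain [CompleteSpace Y] {S : SystemNode X U Y}
    (α : S.RealResolvent) {T : ℝ} (hT : 0 < T) {F : X →L[ℂ] Z} (h : S.CoerciveOnTrajectories T F) :
    S.CoerciveOnDomain α T F := by
  obtain ⟨c, hc, H⟩ := h.le_output α hT
  exact ⟨c, hc, fun u z y _ hy => (H u y hy).trans (le_add_of_nonneg_right (sq_nonneg _))⟩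

end SystemNode

/-- Convexity refers to real scalars, the Hilbert space arguments to complex ones; the two actions
of `1/2` on `L²` agree. -/
theorem midpoint_mem_of_convex {E : Type*} [NormedAddCommGroup E] [InnerProductSpace ℂ E] {T : ℝ}
    {K : Set (L2 T E)} (hK : Convex ℝ K) {u v : L2 T E} (hu : u ∈ K) (hv : v ∈ K) :
    (1 / 2 : ℂ) • u + (1 / 2 : ℂ) • v ∈ K := by
  have h := hK hu hv (by norm_num : (0 : ℝ) ≤ 1 / 2) (by norm_num : (0 : ℝ) ≤ 1 / 2) (by norm_num)
  have e : ∀ w : L2 T E, (1 / 2 : ℂ) • w = (1 / 2 : ℝ) • w := fun w => by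
    refine Lp.ext ?_
    filter_upwards [Lp.coeFn_smul (1 / 2 : ℂ) w, Lp.coeFn_smul (1 / 2 : ℝ) w] with t h1 h2
    rw [h1, h2, Pi.smul_apply, Pi.smul_apply, ← Complex.coe_smul]
    norm_num
  rwa [e, e]

end SysNode

end

/-! ### Existence of an optimal input -/

theorem mainTheorem8
    {X U Y Z Zc : Type*}
    [NormedAddCommGroup X] [InnerProductSpace ℂ X] [CompleteSpace X]
    [NormedAddCommGroup U] [InnerProductSpace ℂ U] [CompleteSpace U]
    [NormedAddCommGroup Y] [InnerProductSpace ℂ Y] [CompleteSpace Y]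
    [NormedAddCommGroup Z] [InnerProductSpace ℂ Z] [CompleteSpace Z]
    [NormedAddCommGroup Zc] [InnerProductSpace ℂ Zc] [CompleteSpace Zc]
    (S : SysNode.SystemNode X U Y) (α : S.RealResolvent) (T : ℝ) (hT : 0 < T)
    (F : X →L[ℂ] Z) (hF : Dense (S.setB α T F))
    (x₀ : S.Extrap α) (zf : Z) (yref : SysNode.L2 T Y)
    (Uad : Set (SysNode.L2 T U)) (hUclosed : IsClosed Uad) (hUconvex : Convex ℝ Uad)
    (hUcoer : Bornology.IsBounded Uad ∨ S.CoerciveOnTrajectories T F ∨ S.CoerciveOnDomain α T F)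
    (Fc : X →L[ℂ] Zc) (hFc : Dense (S.setB α T Fc)) (zc : Zc)
    (hReach : IsClosed (S.reachable α T Fc))
    (hFeas : ∃ u ∈ S.reducedAdmissible α F Fc x₀ zc Uad, ∃ y : SysNode.L2 T Y, S.IsOutput α x₀ u y) :
    ∃ uopt ∈ S.reducedAdmissible α F Fc x₀ zc Uad,
      S.cost α F x₀ zf yref uopt =
        ⨅ u ∈ S.reducedAdmissible α F Fc x₀ zc Uad, S.cost α F x₀ zf yref u := by
  -- The `ℓ²` product of `Z` and `L²` makes the cost half a squared distance in the second
  -- component.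
  set G : Set (SysNode.L2 T U × WithLp 2 (Z × SysNode.L2 T Y)) :=
    {q | q.1 ∈ Uad ∧ S.IsTerminalValue α F x₀ q.1 (WithLp.ofLp q.2).1 ∧
      S.IsTerminalValue α Fc x₀ q.1 zc ∧ S.IsOutput α x₀ q.1 (WithLp.ofLp q.2).2} with hG
  have hc : Continuous fun q : SysNode.L2 T U × WithLp 2 (Z × SysNode.L2 T Y) => WithLp.ofLp q.2 :=
    (WithLp.prod_continuous_ofLp 2 Z (SysNode.L2 T Y)).comp continuous_snd
  have hGcl : IsClosed G :=
    (hUclosed.preimage continuous_fst).inter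
      (((S.isClosed_isTerminalValue α F x₀).preimage (continuous_fst.prodMk hc.fst)).inter
        (((S.isClosed_isTerminalValue α Fc x₀).preimage
          (continuous_fst.prodMk continuous_const)).inter
          ((S.isClosed_isOutput α hT.le x₀).preimage (continuous_fst.prodMk hc.snd))))
  obtain ⟨u₀, ⟨hu₀, ⟨z₀, hz₀⟩, hzc₀⟩, y₀, hy₀⟩ := hFeas
  have hGmid : ∀ p ∈ G, ∀ q ∈ G, (1 / 2 : ℂ) • p + (1 / 2 : ℂ) • q ∈ G := by
    rintro p ⟨p1, p2, p3, p4⟩ q ⟨q1, q2, q3, q4⟩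
    refine ⟨SysNode.midpoint_mem_of_convex hUconvex p1 q1, p2.midpoint hT.le q2, ?_,
      p4.midpoint hT.le q4⟩
    have := p3.midpoint hT.le q3
    rwa [SysNode.SystemNode.half_smul_add_half_smul] at this
  have nsq : ∀ w w' : WithLp 2 (Z × SysNode.L2 T Y), ‖w - w'‖ ^ 2 =
      ‖(WithLp.ofLp w).1 - (WithLp.ofLp w').1‖ ^ 2 + ‖(WithLp.ofLp w).2 - (WithLp.ofLp w').2‖ ^ 2 :=
    fun w w' => WithLp.prod_norm_sq_eq_of_L2 (w - w')
  have hbdd : ∀ R : ℝ, ∃ R' : ℝ, ∀ p ∈ G, ‖p.2 - WithLp.toLp 2 (zf, yref)‖ ≤ R → ‖p.1‖ ≤ R' := by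
    intro R
    have hcoer : Bornology.IsBounded Uad ∨ S.CoerciveOnDomain α T F :=
      hUcoer.imp_right fun h => h.elim (fun h => h.coerciveOnDomain α hT) id
    rcases hcoer with hb | ⟨c, hc0, hcoer⟩
    · obtain ⟨R', hR'⟩ := hb.exists_norm_le
      exact ⟨R', fun p hp _ => hR' p.1 hp.1⟩
    -- Coercivity concerns the homogeneous problem, so it is applied to `p.1 - u₀` with the feasible
    -- input `u₀`. The radius `b` bounds the distance of `p.2` to the feasible pair `w₀`, through
    -- the target `(zf, yref)`.
    · set w₀ : WithLp 2 (Z × SysNode.L2 T Y) := WithLp.toLp 2 (z₀, y₀) with hw₀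
      set b := R + ‖WithLp.toLp 2 (zf, yref) - w₀‖ with hb
      refine ⟨√(b ^ 2 / c) + ‖u₀‖, fun p hp hpR => ?_⟩
      have h1 := hcoer _ _ _ (hp.2.1.sub hT.le hz₀) (hp.2.2.2.sub hT.le hy₀)
      have h2 : ‖p.2 - w₀‖ ≤ b := (norm_sub_le_norm_sub_add_norm_sub _ _ _).trans
        (add_le_add_left hpR _)
      have h3 : ‖p.2 - w₀‖ ^ 2 ≤ b ^ 2 := pow_le_pow_left₀ (norm_nonneg _) h2 2
      rw [nsq, add_comm] at h3
      have h4 : ‖p.1 - u₀‖ ≤ √(b ^ 2 / c) := by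
        refine Real.le_sqrt_of_sq_le ?_
        rw [le_div_iff₀ hc0, mul_comm]
        exact h1.trans h3
      calc ‖p.1‖ = ‖p.1 - u₀ + u₀‖ := by rw [sub_add_cancel]
        _ ≤ _ := norm_add_le _ _
        _ ≤ _ := add_le_add_left h4 _
  obtain ⟨p, hp, hmin⟩ := SysNode.exists_forall_norm_sub_le hGcl
    ⟨(u₀, WithLp.toLp 2 (z₀, y₀)), hu₀, hz₀, hzc₀, hy₀⟩ hGmid (WithLp.toLp 2 (zf, yref)) hbdd
  have hpadm : p.1 ∈ S.reducedAdmissible α F Fc x₀ zc Uad := ⟨hp.1, ⟨_, hp.2.1⟩, hp.2.2.1⟩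
  refine ⟨p.1, hpadm, le_antisymm ?_ (iInf₂_le _ hpadm)⟩
  -- Each competitor with its values `z`, `y` is a point of `G`; an input without output has cost
  -- `∞` and contributes no case.
  refine le_iInf₂ fun u hu => le_iInf fun z => le_iInf fun y => le_iInf fun hz => le_iInf fun hy => ?_
  have hq : (u, WithLp.toLp 2 (z, y)) ∈ G := ⟨hu.1, hz, hu.2.2, hy⟩
  have h1 := pow_le_pow_left₀ (norm_nonneg _) (hmin _ hq) 2
  rw [nsq, nsq] at h1
  exact iInf_le_of_le _ (iInf_le_of_le _ (iInf_le_of_le hp.2.1 (iInf_le_of_le hp.2.2.2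
    (ENNReal.ofReal_le_ofReal (mul_le_mul_of_nonneg_left h1 (by norm_num))))))
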